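/- Let $\omega:[0,\infty)\to[0,\infty)$ be a non-quasianalytic weight function, that is, a continuous (weakly) increasing function such that - ($\alpha$) there is $K\ge 1$ with $\omega(2t)\le K(1+\omega(t))$ for all $t\ge 0$; - ($\beta$) $\int_1^\infty \frac{\omega(t)}{1+t^2}\,dt<\infty$; - ($\gamma$) there are $a\in\mathbb R$, $b>0$ with $\omega(t)\ge a+b\log(1+t)$ for all $t\ge 0$; - ($\delta$) $t\mapsto\omega(e^t)$ is convex on $\mathbb R$. Write $\omega(x):=\omega(|x|)$ for $x\in\mathbb R^N$, with $|\cdot|$ the Euclidean norm, and let $\varphi^*_\omega(s):=\sup_{t\ge 0}\{st-\omega(e^t)\}\in(-\infty,+\infty]$ for $s\ge 0$. All functions are complex-valued, and $\hat f(\xi)=\int_{\mathbb R^N}f(x)e^{-ix\cdot\xi}\,dx$. Let $\mathcal S_\omega(\mathbb R^N)$ be the space of all $f\in L^1(\mathbb R^N)$ such that $f,\hat f\in C^\infty(\mathbb R^N)$ and $\|\exp(\lambda\omega)\partial^\alpha f\|_\infty<\infty$, $\|\exp(\lambda\omega)\partial^\alpha\hat f\|_\infty<\infty$ for all $\lambda>0$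 and $\alpha\in\mathbb N_0^N$, with the locally convex topology generated by the norms $\|\exp(n\omega)\partial^\alpha f\|_\infty+\|\exp(n\omega)\partial^\alpha\hat f\|_\infty$, $n\in\mathbb N=\{1,2,\dots\}$, $\alpha\in\mathbb N_0^N$. Let $\mathcal O_{M,\omega}(\mathbb R^N)$ be the set of all $f\in C^\infty(\mathbb R^N)$ such that for each $m\in\mathbb N$ there are $C>0$ and $n\in\mathbb N$ with $$|\partial^\alpha f(x)|\le C\exp\Big(n\omega(x)+m\varphi^*_\omega\Big(\frac{|\alpha|}{m}\Big)\Big)\qquad\text{for all }\alpha\in\mathbb N_0^N,\ x\in\mathbb R^N$$ (the right-hand side is $+\infty$ where $\varphi^*_\omega(|\alpha|/m)=+\infty$). **Theorem.** Let $f\in C^\infty(\mathbb R^N)$. Then $f\in\mathcal O_{M,\omega}(\mathbb R^N)$ if and only if $fg\in\mathcal S_\omega(\mathbb R^N)$ for every $g\in\mathcal S_\omega(\mathbb R^N)$. Moreover, if $f\in\mathcal O_{M,\omega}(\mathbb R^N)$, then the linear operator $M_f:\mathcal S_\omega(\mathbb R^N)\to\mathcal S_\omega(\mathbb R^N)$,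 $M_f(g):=fg$, is continuous. -/

import Mathlib

noncomputable section

namespace BeurlingMultipliers

/-- `ℝ^N` with its Euclidean norm. -/
abbrev Space (N : ℕ) : Type := EuclideanSpace ℝ (Fin N)

/-- Non-quasianalytic weight functions `ω : [0,∞) → [0,∞)`; only the values of `ω` on `[0,∞)`
matter, here and everywhere below. -/
structure IsWeight (ω : ℝ → ℝ) : Prop where
  continuousOn : ContinuousOn ω (Set.Ici 0)
  monotoneOn : MonotoneOn ω (Set.Ici 0)
  nonneg : ∀ t, 0 ≤ t → 0 ≤ ω t
  /-- condition `(α)` -/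
  alpha : ∃ K : ℝ, 1 ≤ K ∧ ∀ t, 0 ≤ t → ω (2 * t) ≤ K * (1 + ω t)
  /-- condition `(β)` -/
  beta : MeasureTheory.IntegrableOn (fun t => ω t / (1 + t ^ 2)) (Set.Ici 1)
  /-- condition `(γ)` -/
  gamma : ∃ a b : ℝ, 0 < b ∧ ∀ t, 0 ≤ t → a + b * Real.log (1 + t) ≤ ω t
  /-- condition `(δ)` -/
  delta : ConvexOn ℝ Set.univ (fun t : ℝ => ω (Real.exp t))

/-- The Young conjugate `φ*(s) = sup_{t ≥ 0} (s t - ω(e^t))`. The supremum is taken in the extended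
reals: it is `+∞` for large `s` when `ω` grows like a logarithm. -/
def youngConj (ω : ℝ → ℝ) (s : ℝ) : EReal :=
  ⨆ t : {t : ℝ // 0 ≤ t}, ((s * t.1 - ω (Real.exp t.1) : ℝ) : EReal)

/-- The partial derivative `∂_i f`. -/
def partialD {N : ℕ} (i : Fin N) (f : Space N → ℂ) : Space N → ℂ :=
  fun x => fderiv ℝ f x (EuclideanSpace.single i 1)

/-- The derivative `∂^α f = ∂_1^{α_1} ⋯ ∂_N^{α_N} f` for a multi-index `α`. -/
def multiD {N : ℕ} (α : Fin N → ℕ) (f : Space N → ℂ) : Space N → ℂ :=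
  (List.finRange N).foldr (fun i h => (partialD i)^[α i] h) f

/-- The length `|α|` of a multi-index. -/
def mlen {N : ℕ} (α : Fin N → ℕ) : ℕ := ∑ i, α i

/-- The Fourier transform `f̂(ξ) = ∫ f(x) e^{-i x·ξ} dx`. -/
def fourierT {N : ℕ} (f : Space N → ℂ) : Space N → ℂ :=
  fun ξ => ∫ x, f x * Complex.exp (-(Complex.I * ((inner ℝ x ξ : ℝ) : ℂ)))

section auxiliary

variable {N : ℕ}

theorem partialD_contDiff (i : Fin N) {f : Space N → ℂ} (hf : ContDiff ℝ (⊤ : ℕ∞) f) :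
    ContDiff ℝ (⊤ : ℕ∞) (partialD i f) :=
  (hf.fderiv_right (m := (⊤ : ℕ∞)) (by simp)).clm_apply contDiff_const

theorem partialD_add (i : Fin N) {f g : Space N → ℂ} (hf : ContDiff ℝ (⊤ : ℕ∞) f)
    (hg : ContDiff ℝ (⊤ : ℕ∞) g) : partialD i (f + g) = partialD i f + partialD i g := by
  funext x
  simp [partialD, fderiv_add (hf.differentiable (by simp) x) (hg.differentiable (by simp) x)]

theorem partialD_smul (i : Fin N) (c : ℂ) {f : Space N → ℂ} (hf : ContDiff ℝ (⊤ : ℕ∞) f) :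
    partialD i (c • f) = c • partialD i f := by
  funext x
  simp [partialD, fderiv_const_smul (hf.differentiable (by simp) x) c]

theorem iter_partialD_contDiff (i : Fin N) (k : ℕ) {f : Space N → ℂ} (hf : ContDiff ℝ (⊤ : ℕ∞) f) :
    ContDiff ℝ (⊤ : ℕ∞) ((partialD i)^[k] f) := by
  induction k with
  | zero => exact hf
  | succ k ih => rw [Function.iterate_succ_apply']; exact partialD_contDiff i ih

theorem iter_partialD_add (i : Fin N) (k : ℕ) {f g : Space N → ℂ} (hf : ContDiff ℝ (⊤ : ℕ∞) f)
    (hg : ContDiff ℝ (⊤ : ℕ∞) g) :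
    (partialD i)^[k] (f + g) = (partialD i)^[k] f + (partialD i)^[k] g := by
  induction k with
  | zero => rfl
  | succ k ih =>
    simp only [Function.iterate_succ_apply', ih]
    exact partialD_add i (iter_partialD_contDiff i k hf) (iter_partialD_contDiff i k hg)

theorem iter_partialD_smul (i : Fin N) (k : ℕ) (c : ℂ) {f : Space N → ℂ}
    (hf : ContDiff ℝ (⊤ : ℕ∞) f) : (partialD i)^[k] (c • f) = c • (partialD i)^[k] f := by
  induction k with
  | zero => rfl
  | succ k ih =>
    simp only [Function.iterate_succ_apply', ih]
    exact partialD_smul i c (iter_partialD_contDiff i k hf)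

theorem foldr_contDiff (l : List (Fin N)) (α : Fin N → ℕ) {f : Space N → ℂ}
    (hf : ContDiff ℝ (⊤ : ℕ∞) f) :
    ContDiff ℝ (⊤ : ℕ∞) (l.foldr (fun i h => (partialD i)^[α i] h) f) := by
  induction l with
  | nil => exact hf
  | cons i l ih => exact iter_partialD_contDiff i (α i) ih

theorem multiD_contDiff (α : Fin N → ℕ) {f : Space N → ℂ} (hf : ContDiff ℝ (⊤ : ℕ∞) f) :
    ContDiff ℝ (⊤ : ℕ∞) (multiD α f) :=
  foldr_contDiff _ α hf

theorem multiD_add (α : Fin N → ℕ) {f g : Space N → ℂ} (hf : ContDiff ℝ (⊤ : ℕ∞) f)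
    (hg : ContDiff ℝ (⊤ : ℕ∞) g) : multiD α (f + g) = multiD α f + multiD α g := by
  unfold multiD
  induction List.finRange N with
  | nil => rfl
  | cons i l ih =>
    simp only [List.foldr_cons, ih]
    exact iter_partialD_add i (α i) (foldr_contDiff l α hf) (foldr_contDiff l α hg)

theorem multiD_smul (α : Fin N → ℕ) (c : ℂ) {f : Space N → ℂ} (hf : ContDiff ℝ (⊤ : ℕ∞) f) :
    multiD α (c • f) = c • multiD α f := by
  unfold multiD
  induction List.finRange N with
  | nil => rfl
  | cons i l ih =>
    simp only [List.foldr_cons, ih]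
    exact iter_partialD_smul i (α i) c (foldr_contDiff l α hf)

theorem fourierT_integrable {f : Space N → ℂ} (hf : MeasureTheory.Integrable f) (ξ : Space N) :
    MeasureTheory.Integrable
      (fun x => f x * Complex.exp (-(Complex.I * ((inner ℝ x ξ : ℝ) : ℂ)))) := by
  refine hf.mul_bdd (c := 1) (by fun_prop) (Filter.Eventually.of_forall fun x => ?_)
  simp [Complex.norm_exp]

theorem fourierT_add {f g : Space N → ℂ} (hf : MeasureTheory.Integrable f)
    (hg : MeasureTheory.Integrable g) : fourierT (f + g) = fourierT f + fourierT g := by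
  funext ξ
  simp only [fourierT, Pi.add_apply, add_mul]
  exact MeasureTheory.integral_add (fourierT_integrable hf ξ) (fourierT_integrable hg ξ)

theorem fourierT_smul (c : ℂ) (f : Space N → ℂ) : fourierT (c • f) = c • fourierT f := by
  funext ξ
  simp only [fourierT, Pi.smul_apply, smul_eq_mul, mul_assoc]
  exact MeasureTheory.integral_const_mul _ _

end auxiliary

/-- `‖exp(λ ω) h‖_∞ < ∞`. -/
def WeightedBdd {N : ℕ} (ω : ℝ → ℝ) (l : ℝ) (h : Space N → ℂ) : Prop :=
  BddAbove (Set.range fun x : Space N => Real.exp (l * ω ‖x‖) * ‖h x‖)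

/-- `‖exp(λ ω) h‖_∞`, a supremum of real numbers, to be used when `WeightedBdd ω l h`. -/
def weightedSup {N : ℕ} (ω : ℝ → ℝ) (l : ℝ) (h : Space N → ℂ) : ℝ :=
  ⨆ x : Space N, Real.exp (l * ω ‖x‖) * ‖h x‖

section auxiliary

variable {N : ℕ} {ω : ℝ → ℝ} {l : ℝ}

theorem WeightedBdd.le {h : Space N → ℂ} (hh : WeightedBdd ω l h) (x : Space N) :
    Real.exp (l * ω ‖x‖) * ‖h x‖ ≤ weightedSup ω l h :=
  le_ciSup hh x

theorem weightedBdd_zero : WeightedBdd ω l (0 : Space N → ℂ) :=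
  ⟨0, by rintro _ ⟨x, rfl⟩; simp⟩

theorem WeightedBdd.add_le {h k : Space N → ℂ} (hh : WeightedBdd ω l h)
    (hk : WeightedBdd ω l k) (x : Space N) :
    Real.exp (l * ω ‖x‖) * ‖(h + k) x‖ ≤ weightedSup ω l h + weightedSup ω l k :=
  calc Real.exp (l * ω ‖x‖) * ‖(h + k) x‖
      ≤ Real.exp (l * ω ‖x‖) * (‖h x‖ + ‖k x‖) := by
        gcongr; exact norm_add_le _ _
    _ = Real.exp (l * ω ‖x‖) * ‖h x‖ + Real.exp (l * ω ‖x‖) * ‖k x‖ := by ring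
    _ ≤ _ := by gcongr; exacts [hh.le x, hk.le x]

theorem WeightedBdd.add {h k : Space N → ℂ} (hh : WeightedBdd ω l h)
    (hk : WeightedBdd ω l k) : WeightedBdd ω l (h + k) :=
  ⟨_, by rintro _ ⟨x, rfl⟩; exact hh.add_le hk x⟩

theorem weightedSup_add {h k : Space N → ℂ} (hh : WeightedBdd ω l h)
    (hk : WeightedBdd ω l k) :
    weightedSup ω l (h + k) ≤ weightedSup ω l h + weightedSup ω l k :=
  ciSup_le (hh.add_le hk)

theorem weightedSup_smul (c : ℂ) (h : Space N → ℂ) :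
    weightedSup ω l (c • h) = ‖c‖ * weightedSup ω l h := by
  unfold weightedSup
  rw [Real.mul_iSup_of_nonneg (norm_nonneg c)]
  congr 1; funext x
  simp only [Pi.smul_apply, smul_eq_mul, norm_mul]; ring

theorem WeightedBdd.smul (c : ℂ) {h : Space N → ℂ} (hh : WeightedBdd ω l h) :
    WeightedBdd ω l (c • h) := by
  refine ⟨‖c‖ * weightedSup ω l h, ?_⟩
  rintro _ ⟨x, rfl⟩
  calc Real.exp (l * ω ‖x‖) * ‖(c • h) x‖
      = ‖c‖ * (Real.exp (l * ω ‖x‖) * ‖h x‖) := by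
        simp only [Pi.smul_apply, smul_eq_mul, norm_mul]; ring
    _ ≤ _ := by gcongr; exact hh.le x

end auxiliary

/-- `f` belongs to `S_ω(ℝ^N)`: `f ∈ L¹`, `f` and `f̂` are smooth, and all the functions
`exp(λ ω) ∂^α f` and `exp(λ ω) ∂^α f̂`, `λ > 0`, are bounded. -/
structure MemS (N : ℕ) (ω : ℝ → ℝ) (f : Space N → ℂ) : Prop where
  integrable : MeasureTheory.Integrable f
  contDiff : ContDiff ℝ (⊤ : ℕ∞) f
  contDiff_fourier : ContDiff ℝ (⊤ : ℕ∞) (fourierT f)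
  bdd : ∀ l : ℝ, 0 < l → ∀ α : Fin N → ℕ, WeightedBdd ω l (multiD α f)
  bdd_fourier : ∀ l : ℝ, 0 < l → ∀ α : Fin N → ℕ, WeightedBdd ω l (multiD α (fourierT f))

theorem MemS.add {N : ℕ} {ω : ℝ → ℝ} {f g : Space N → ℂ} (hf : MemS N ω f) (hg : MemS N ω g) :
    MemS N ω (f + g) where
  integrable := hf.integrable.add hg.integrable
  contDiff := hf.contDiff.add hg.contDiff
  contDiff_fourier := by
    rw [fourierT_add hf.integrable hg.integrable]
    exact hf.contDiff_fourier.add hg.contDiff_fourier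
  bdd l hl α := by
    rw [multiD_add α hf.contDiff hg.contDiff]
    exact (hf.bdd l hl α).add (hg.bdd l hl α)
  bdd_fourier l hl α := by
    rw [fourierT_add hf.integrable hg.integrable,
      multiD_add α hf.contDiff_fourier hg.contDiff_fourier]
    exact (hf.bdd_fourier l hl α).add (hg.bdd_fourier l hl α)

theorem MemS.smul {N : ℕ} {ω : ℝ → ℝ} (c : ℂ) {f : Space N → ℂ} (hf : MemS N ω f) :
    MemS N ω (c • f) where
  integrable := hf.integrable.smul c
  contDiff := hf.contDiff.const_smul c
  contDiff_fourier := by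
    rw [fourierT_smul]
    exact hf.contDiff_fourier.const_smul c
  bdd l hl α := by
    rw [multiD_smul α c hf.contDiff]
    exact (hf.bdd l hl α).smul c
  bdd_fourier l hl α := by
    rw [fourierT_smul, multiD_smul α c hf.contDiff_fourier]
    exact (hf.bdd_fourier l hl α).smul c

theorem multiD_zero {N : ℕ} (α : Fin N → ℕ) : multiD α (0 : Space N → ℂ) = 0 := by
  have h := multiD_smul α 0 (f := (0 : Space N → ℂ)) contDiff_const
  simpa using h

theorem fourierT_zero {N : ℕ} : fourierT (0 : Space N → ℂ) = 0 := by
  have h := fourierT_smul 0 (0 : Space N → ℂ)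
  simpa using h

theorem memS_zero (N : ℕ) (ω : ℝ → ℝ) : MemS N ω 0 where
  integrable := MeasureTheory.integrable_zero _ _ _
  contDiff := contDiff_const
  contDiff_fourier := by rw [fourierT_zero]; exact contDiff_const
  bdd l _ α := by rw [multiD_zero]; exact weightedBdd_zero
  bdd_fourier l _ α := by rw [fourierT_zero, multiD_zero]; exact weightedBdd_zero

/-- `S_ω(ℝ^N)` as a linear subspace of the space of all functions. -/
def sSubmodule (N : ℕ) (ω : ℝ → ℝ) : Submodule ℂ (Space N → ℂ) where
  carrier := {f | MemS N ω f}
  add_mem' hf hg := MemS.add hf hg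
  zero_mem' := memS_zero N ω
  smul_mem' c _ hf := MemS.smul c hf

/-- The vector space `S_ω(ℝ^N)`. It is a type of its own, so that it does not carry the topology of
pointwise convergence. -/
def S (N : ℕ) (ω : ℝ → ℝ) : Type := ↥(sSubmodule N ω)

namespace S

variable (N : ℕ) (ω : ℝ → ℝ)

instance : AddCommGroup (S N ω) := inferInstanceAs (AddCommGroup ↥(sSubmodule N ω))

instance : Module ℂ (S N ω) := inferInstanceAs (Module ℂ ↥(sSubmodule N ω))

variable {N ω}

/-- The function underlying an element of `S_ω(ℝ^N)`. -/
def toFun (g : S N ω) : Space N → ℂ := g.1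

theorem memS (g : S N ω) : MemS N ω g.toFun := g.2

theorem toFun_add (g h : S N ω) : (g + h).toFun = g.toFun + h.toFun := rfl

theorem toFun_smul (c : ℂ) (g : S N ω) : (c • g).toFun = c • g.toFun := rfl

variable (N ω)

/-- The norms `‖exp(n ω) ∂^α g‖_∞ + ‖exp(n ω) ∂^α ĝ‖_∞` on `S_ω(ℝ^N)`, for `n ≥ 1` and multi-indices
`α`. -/
def seminormFamily : SeminormFamily ℂ (S N ω) (ℕ+ × (Fin N → ℕ)) := fun p =>
  Seminorm.of
    (fun g => weightedSup ω (p.1 : ℕ) (multiD p.2 g.toFun)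
      + weightedSup ω (p.1 : ℕ) (multiD p.2 (fourierT g.toFun)))
    (fun g h => by
      have hp : (0 : ℝ) < ((p.1 : ℕ) : ℝ) := by exact_mod_cast p.1.pos
      have hg := g.memS
      have hh := h.memS
      rw [toFun_add, fourierT_add hg.integrable hh.integrable,
        multiD_add _ hg.contDiff hh.contDiff,
        multiD_add _ hg.contDiff_fourier hh.contDiff_fourier]
      have h1 := weightedSup_add (hg.bdd _ hp p.2) (hh.bdd _ hp p.2)
      have h2 := weightedSup_add (hg.bdd_fourier _ hp p.2) (hh.bdd_fourier _ hp p.2)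
      linarith)
    (fun c g => by
      have hg := g.memS
      rw [toFun_smul, fourierT_smul, multiD_smul _ c hg.contDiff,
        multiD_smul _ c hg.contDiff_fourier, weightedSup_smul, weightedSup_smul, mul_add])

/-- The locally convex topology of `S_ω(ℝ^N)`, generated by the norms above. -/
instance : TopologicalSpace (S N ω) := (seminormFamily N ω).moduleFilterBasis.topology

theorem withSeminorms : WithSeminorms (seminormFamily N ω) := ⟨rfl⟩

end S

/-- The space `O_{M,ω}(ℝ^N)` of slowly increasing functions of Beurling type: smooth functions `f`
such that for each `m ≥ 1` there are `C > 0` and `n ≥ 1` with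
`|∂^α f(x)| ≤ C exp(n ω(x) + m φ*(|α|/m))` for all `α` and `x`. The right-hand side is `+∞` where
`φ*(|α|/m)` is. -/
def OM (N : ℕ) (ω : ℝ → ℝ) : Set (Space N → ℂ) :=
  {f | ContDiff ℝ (⊤ : ℕ∞) f ∧ ∀ m : ℕ, 1 ≤ m → ∃ C : ℝ, 0 < C ∧ ∃ n : ℕ, 1 ≤ n ∧
    ∀ (α : Fin N → ℕ) (x : Space N),
      ENNReal.ofReal ‖multiD α f x‖ ≤ ENNReal.ofReal C *
        EReal.exp (((n * ω ‖x‖ : ℝ) : EReal)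
          + ((m : ℝ) : EReal) * youngConj ω ((mlen α : ℝ) / m))}

end BeurlingMultipliers

end

open MeasureTheory Filter Topology
open scoped FourierTransform

/-!
# Multipliers of the Beurling-type space `S_ω`

Write `γ` for the Gaussian `exp(-π |y|²)`, `γ_x = γ(· - x)`, and let `W l k` be the growth
sequence `sup_{r ≥ 1} r ^ k * exp(-l ω(r))`, which is `exp(l φ*(k / l))`. The bounds defining
`O_{M,ω}` become `|∂^α f| ≤ C exp(n ω) W m |α|` (`mem_OM_iff`).

The central estimate is `exists_iteratedFDeriv_le_of_windowed`: if the Fourier transform of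
`f γ_x` decays like `D exp(-L ω)` with `L` large, then the derivatives of `f` of order `k` at `x` are
at most `C D W l k`. This is Fourier inversion for `f γ_x`, followed by Leibniz' rule for
`f = (f γ_x) γ_x⁻¹`. The derivatives of `γ_x⁻¹` at `x` are of size `k! A ^ k`, which `W l k` dominates
because `(β)` implies `ω(t) = o(t)`, and the geometric factors are absorbed by means of `(α)`.

If `h` and its Fourier transform decay faster than `exp(-l ω)` for all `l`, then so does the
Fourier transform of `h γ_x`, jointly in time and frequency: it inherits one decay from `h`, the
other from the Fourier transform of `h`, and the geometric mean has both. Hence all derivatives of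
`h` decay and obey the growth sequence (`exists_iteratedFDeriv_le_of_decay`), and `S_ω` is
determined by the decay of a function and of its Fourier transform alone (`memS_of_decay`,
`exists_decay_multiD`).

If `f ∈ O_{M,ω}` and `g ∈ S_ω`, then the derivatives of `f g` in a coordinate direction are
integrable with norms bounded by the growth sequence. Integrating by parts, and optimizing over
the order of the derivative with the biconjugate theorem for the convex function `t ↦ ω(e^t)`
(`exists_growth_le`, the only use of `(δ)`), one gets the decay of the Fourier transform of `f g`,
with constants that are linear in norms of `g` (`exists_decay_mul`). This gives the first
implication and the continuity of the multiplication operator.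

Conversely, let `f` be a multiplier of `S_ω`. By the central estimate it is enough that the
Fourier transform of `f γ_x` at `ξ` be at most `C exp(n ω(x) - l ω(ξ))`. If it is not, at a
sequence of points `x_j`, the superpositions `∑ a_j d_j γ_{x_j}` with `a ∈ ℓ¹` and
`d_j = exp(-(j + 1) ω(x_j))` belong to `S_ω`, and the uniform boundedness principle on the Banach space `ℓ¹`
gives a contradiction (`exists_decay_fourier_windowed`).
-/

noncomputable section

namespace BeurlingMultipliers

/-! ### Weight functions -/

namespace IsWeight

variable {ω : ℝ → ℝ}

theorem add_le (hω : IsWeight ω) : ∃ K : ℝ, 1 ≤ K ∧ ∀ s t, 0 ≤ s → 0 ≤ t →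
    ω (s + t) ≤ K * (1 + ω s + ω t) := by
  obtain ⟨K, hK, h⟩ := hω.alpha
  have key : ∀ s t, 0 ≤ s → s ≤ t → ω (s + t) ≤ K * (1 + ω s + ω t) := fun s t hs hst =>
    calc ω (s + t) ≤ ω (2 * t) :=
          hω.monotoneOn (Set.mem_Ici.2 (by linarith)) (Set.mem_Ici.2 (by linarith)) (by linarith)
      _ ≤ K * (1 + ω t) := h t (hs.trans hst)
      _ ≤ K * (1 + ω s + ω t) := by
          have := hω.nonneg s hs
          gcongr
          linarith
  refine ⟨K, hK, fun s t hs ht => ?_⟩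
  rcases le_total s t with hst | hst
  · exact key s t hs hst
  · have := key t s ht hst
    rw [add_comm t s] at this
    linarith

theorem mul_le (hω : IsWeight ω) (A : ℝ) (hA : 0 ≤ A) : ∃ K : ℝ, 1 ≤ K ∧ ∀ t, 0 ≤ t →
    ω (A * t) ≤ K * (1 + ω t) := by
  obtain ⟨K, hK, h⟩ := hω.alpha
  have key : ∀ n : ℕ, ∃ L : ℝ, 1 ≤ L ∧ ∀ t, 0 ≤ t → ω (2 ^ n * t) ≤ L * (1 + ω t) := by
    intro n
    induction n with
    | zero => exact ⟨1, le_rfl, fun t ht => by simp⟩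
    | succ n ih =>
      obtain ⟨L, hL, hn⟩ := ih
      refine ⟨K * (1 + L), by nlinarith, fun t ht => ?_⟩
      have h0 := hω.nonneg t ht
      calc ω (2 ^ (n + 1) * t) = ω (2 * (2 ^ n * t)) := by ring_nf
        _ ≤ K * (1 + ω (2 ^ n * t)) := h _ (by positivity)
        _ ≤ K * (1 + L * (1 + ω t)) := by gcongr; exact hn t ht
        _ ≤ K * ((1 + L) * (1 + ω t)) := by gcongr; nlinarith
        _ = K * (1 + L) * (1 + ω t) := by ring
  obtain ⟨n, hn⟩ := pow_unbounded_of_one_lt A (one_lt_two)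
  obtain ⟨L, hL, hn'⟩ := key n
  refine ⟨L, hL, fun t ht => (hω.monotoneOn ?_ ?_ ?_).trans (hn' t ht)⟩
  · exact Set.mem_Ici.2 (by positivity)
  · exact Set.mem_Ici.2 (by positivity)
  · gcongr

/-- Condition `(β)` forces `ω(t) = o(t)`: the integral of `ω(t) / (1 + t²)` over `[R, 2R]` is at
least `ω(R) / (5R)`. -/
theorem le_mul_add (hω : IsWeight ω) (ε : ℝ) (hε : 0 < ε) : ∃ C : ℝ, 0 ≤ C ∧ ∀ t, 0 ≤ t →
    ω t ≤ ε * t + C := by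
  set F : ℝ → ℝ := fun t => ω t / (1 + t ^ 2) with hF
  have hint : IntegrableOn F (Set.Ioi 1) := hω.beta.mono_set Set.Ioi_subset_Ici_self
  have h1 := intervalIntegral_tendsto_integral_Ioi 1 hint tendsto_id
  have h2 := intervalIntegral_tendsto_integral_Ioi 1 hint
    (tendsto_id.const_mul_atTop (zero_lt_two (α := ℝ)))
  have h3 : Tendsto (fun R : ℝ => (∫ t in (1 : ℝ)..(2 * R), F t) - ∫ t in (1 : ℝ)..R, F t) atTop
      (𝓝 0) := by simpa using h2.sub h1
  obtain ⟨R₀, hR₀⟩ := eventually_atTop.1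
    (h3.eventually (gt_mem_nhds (show 0 < ε / 5 by positivity)))
  have hii : ∀ a b : ℝ, 1 ≤ a → 1 ≤ b → IntervalIntegrable F volume a b := fun a b ha hb =>
    (hω.beta.mono_set (fun x hx => Set.mem_Ici.2 ((le_min ha hb).trans hx.1))).intervalIntegrable
  have key : ∀ R, max R₀ 1 ≤ R → ω R ≤ ε * R := by
    intro R hR
    have hR1 : 1 ≤ R := (le_max_right _ _).trans hR
    have hlt := hR₀ R ((le_max_left _ _).trans hR)
    rw [intervalIntegral.integral_interval_sub_left (hii _ _ le_rfl (by linarith))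
      (hii _ _ le_rfl hR1)] at hlt
    have hle : ∫ _ in R..(2 * R), ω R / (5 * R ^ 2) ≤ ∫ t in R..(2 * R), F t := by
      refine intervalIntegral.integral_mono_on (by linarith) (by simp)
        (hii _ _ hR1 (by linarith)) fun t ht => ?_
      have hm : ω R ≤ ω t := hω.monotoneOn (Set.mem_Ici.2 (by linarith))
        (Set.mem_Ici.2 (by linarith [ht.1])) ht.1
      have h0 := hω.nonneg R (by linarith)
      simp only [hF]
      have ht1 := ht.1
      have ht2 := ht.2
      have h5 : 1 + t ^ 2 ≤ 5 * R ^ 2 := by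
        nlinarith [mul_self_le_mul_self (by linarith : 0 ≤ t) ht2]
      exact div_le_div₀ (h0.trans hm) hm (by positivity) h5
    rw [intervalIntegral.integral_const, smul_eq_mul] at hle
    have : (2 * R - R) * (ω R / (5 * R ^ 2)) = ω R / (5 * R) := by
      field_simp; ring
    rw [this] at hle
    have := hle.trans hlt.le
    rw [div_le_div_iff₀ (by positivity) (by positivity)] at this
    linarith
  refine ⟨ω (max R₀ 1), hω.nonneg _ (by positivity), fun t ht => ?_⟩
  rcases le_total t (max R₀ 1) with h | h
  · have := hω.monotoneOn (Set.mem_Ici.2 ht) (Set.mem_Ici.2 (by positivity)) h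
    have : 0 ≤ ε * t := by positivity
    linarith
  · linarith [key t h, hω.nonneg (max R₀ 1) (by positivity)]

theorem one_add_le_exp (hω : IsWeight ω) : ∃ c C : ℝ, 0 < c ∧ 0 < C ∧ ∀ t, 0 ≤ t →
    1 + t ≤ C * Real.exp (c * ω t) := by
  obtain ⟨a, b, hb, h⟩ := hω.gamma
  refine ⟨1 / b, Real.exp (-a / b), by positivity, by positivity, fun t ht => ?_⟩
  rw [← Real.exp_add, ← Real.log_le_iff_le_exp (by positivity)]
  have := h t ht
  have h2 : -a / b + 1 / b * ω t = (ω t - a) / b := by ring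
  rw [h2, le_div_iff₀ hb]
  linarith

theorem continuous_comp_norm (hω : IsWeight ω) {E : Type*} [SeminormedAddCommGroup E] :
    Continuous fun x : E => ω ‖x‖ :=
  hω.continuousOn.comp_continuous continuous_norm fun x => Set.mem_Ici.2 (norm_nonneg x)

theorem integrable_exp_neg (hω : IsWeight ω) (N : ℕ) : ∃ c : ℝ, 0 < c ∧
    Integrable fun x : Space N => Real.exp (-(c * ω ‖x‖)) := by
  obtain ⟨c, C, hc, hC, h⟩ := hω.one_add_le_exp
  refine ⟨c * (N + 1), by positivity, ?_⟩
  have hi : Integrable fun x : Space N => C ^ (N + 1) * (1 + ‖x‖) ^ (-((N : ℝ) + 1)) :=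
    (integrable_one_add_norm (by simp)).const_mul _
  refine hi.mono' ?_ (Eventually.of_forall fun x => ?_)
  · have := hω.continuous_comp_norm (E := Space N)
    exact (Real.continuous_exp.comp (this.const_mul _).neg).aestronglyMeasurable
  · have hx := h ‖x‖ (norm_nonneg x)
    rw [Real.norm_of_nonneg (Real.exp_pos _).le, Real.exp_neg,
      Real.rpow_neg (by positivity), ← div_eq_mul_inv, inv_eq_one_div,
      div_le_div_iff₀ (Real.exp_pos _) (by positivity), one_mul]
    calc (1 + ‖x‖) ^ ((N : ℝ) + 1) = (1 + ‖x‖) ^ (N + 1) := by exact_mod_cast Real.rpow_natCast _ _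
      _ ≤ (C * Real.exp (c * ω ‖x‖)) ^ (N + 1) := by gcongr
      _ = C ^ (N + 1) * Real.exp (c * (N + 1) * ω ‖x‖) := by
        rw [mul_pow, ← Real.exp_nat_mul]; push_cast; ring_nf

theorem integrable_exp_neg_of_le (hω : IsWeight ω) {N : ℕ} {c d : ℝ} (hcd : c ≤ d)
    (h : Integrable fun x : Space N => Real.exp (-(c * ω ‖x‖))) :
    Integrable fun x : Space N => Real.exp (-(d * ω ‖x‖)) := by
  refine h.mono' ?_ (Eventually.of_forall fun x => ?_)
  · have := hω.continuous_comp_norm (E := Space N)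
    exact (Real.continuous_exp.comp (this.const_mul _).neg).aestronglyMeasurable
  · rw [Real.norm_of_nonneg (Real.exp_pos _).le]
    have := hω.nonneg ‖x‖ (norm_nonneg x)
    gcongr

theorem exp_mul_gaussian_le (hω : IsWeight ω) (l a : ℝ) (hl : 0 ≤ l) (ha : 0 < a) :
    ∃ C : ℝ, 0 < C ∧ ∀ t, 0 ≤ t → Real.exp (l * ω t) * Real.exp (-(a * t ^ 2)) ≤ C := by
  obtain ⟨C, hC, h⟩ := hω.le_mul_add 1 one_pos
  refine ⟨Real.exp (l * C + l ^ 2 / (4 * a)), Real.exp_pos _, fun t ht => ?_⟩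
  rw [← Real.exp_add, Real.exp_le_exp]
  have h1 : l * ω t ≤ l * (1 * t + C) := by gcongr; exact h t ht
  have h2 : 0 ≤ (2 * a * t - l) ^ 2 / (4 * a) := by positivity
  have h3 : (2 * a * t - l) ^ 2 / (4 * a) = a * t ^ 2 - l * t + l ^ 2 / (4 * a) := by
    field_simp; ring
  linarith

end IsWeight

/-! ### The growth sequence of a weight -/

/-- The quantities `r ^ k * exp(-l ω(r))`, `r ≥ 1`, are bounded above; equivalently, the Young
conjugate of `ω` is finite at `k / l`. -/
def GrowthFinite (ω : ℝ → ℝ) (l : ℝ) (k : ℕ) : Prop :=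
  BddAbove (Set.range fun r : {r : ℝ // 1 ≤ r} => r.1 ^ k * Real.exp (-(l * ω r.1)))

/-- The real number `exp(l φ*(k / l)) = sup_{r ≥ 1} r ^ k * exp(-l ω(r))`, to be used when
`GrowthFinite ω l k`. -/
def growth (ω : ℝ → ℝ) (l : ℝ) (k : ℕ) : ℝ :=
  ⨆ r : {r : ℝ // 1 ≤ r}, r.1 ^ k * Real.exp (-(l * ω r.1))

section growth

variable {ω : ℝ → ℝ} {l m : ℝ} {j k n : ℕ}

instance : Nonempty {r : ℝ // 1 ≤ r} := ⟨⟨1, le_rfl⟩⟩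

theorem GrowthFinite.le (h : GrowthFinite ω l k) {r : ℝ} (hr : 1 ≤ r) :
    r ^ k * Real.exp (-(l * ω r)) ≤ growth ω l k :=
  le_ciSup h (⟨r, hr⟩ : {r : ℝ // 1 ≤ r})

theorem GrowthFinite.intro {B : ℝ} (h : ∀ r, 1 ≤ r → r ^ k * Real.exp (-(l * ω r)) ≤ B) :
    GrowthFinite ω l k :=
  ⟨B, by rintro _ ⟨r, rfl⟩; exact h r.1 r.2⟩

theorem growth_le {B : ℝ} (h : ∀ r, 1 ≤ r → r ^ k * Real.exp (-(l * ω r)) ≤ B) :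
    growth ω l k ≤ B :=
  ciSup_le fun r => h r.1 r.2

theorem GrowthFinite.exp_le (h : GrowthFinite ω l k) : Real.exp (-(l * ω 1)) ≤ growth ω l k := by
  simpa using h.le le_rfl

theorem GrowthFinite.pos (h : GrowthFinite ω l k) : 0 < growth ω l k :=
  (Real.exp_pos _).trans_le h.exp_le

theorem GrowthFinite.of_le (h : GrowthFinite ω l k) (hjk : j ≤ k) : GrowthFinite ω l j :=
  .intro fun r hr => le_trans (by gcongr) (h.le hr)

theorem growthFinite_zero (hω : IsWeight ω) (hl : 0 ≤ l) : GrowthFinite ω l 0 :=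
  .intro (B := 1) fun r hr => by
    have := hω.nonneg r (by linarith)
    rw [pow_zero, one_mul, Real.exp_le_one_iff]
    nlinarith [mul_nonneg hl this]

/-- Superadditivity of the Young conjugate. For `r ≤ s` one has `r ^ j * s ^ k ≤ s ^ (j + k)`, so
no convexity is needed. -/
theorem GrowthFinite.mul_le (hω : IsWeight ω) (hl : 0 ≤ l) (h : GrowthFinite ω l (j + k)) :
    growth ω l j * growth ω l k ≤ growth ω l (j + k) := by
  have key : ∀ r s, 1 ≤ r → 1 ≤ s → (r ^ j * Real.exp (-(l * ω r))) *
      (s ^ k * Real.exp (-(l * ω s))) ≤ growth ω l (j + k) := by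
    intro r s hr hs
    have hr' : Real.exp (-(l * ω r)) ≤ 1 := by
      rw [Real.exp_le_one_iff]; nlinarith [mul_nonneg hl (hω.nonneg r (by linarith))]
    have hs' : Real.exp (-(l * ω s)) ≤ 1 := by
      rw [Real.exp_le_one_iff]; nlinarith [mul_nonneg hl (hω.nonneg s (by linarith))]
    rcases le_total r s with hrs | hrs
    · calc _ ≤ (s ^ j * 1) * (s ^ k * Real.exp (-(l * ω s))) := by gcongr
        _ = s ^ (j + k) * Real.exp (-(l * ω s)) := by ring
        _ ≤ _ := h.le hs
    · calc _ ≤ (r ^ j * Real.exp (-(l * ω r))) * (r ^ k * 1) := by gcongr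
        _ = r ^ (j + k) * Real.exp (-(l * ω r)) := by ring
        _ ≤ _ := h.le hr
  have hk := (h.of_le (Nat.le_add_left k j)).pos
  rw [← le_div_iff₀ hk]
  refine growth_le fun r hr => ?_
  rw [le_div_iff₀ hk, mul_comm, ← le_div_iff₀ (by positivity)]
  refine growth_le fun s hs => ?_
  rw [le_div_iff₀ (by positivity), mul_comm]
  exact key r s hr hs

/-- A geometric factor `A ^ k` is absorbed by passing to a larger parameter, thanks to `(α)`. -/
theorem exists_pow_mul_growth_le (hω : IsWeight ω) {A : ℝ} (hA : 1 ≤ A) (hl : 0 < l) :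
    ∃ l₀ C : ℝ, 0 < l₀ ∧ 0 < C ∧ ∀ m, l₀ ≤ m → ∀ k, GrowthFinite ω l k →
      GrowthFinite ω m k ∧ A ^ k * growth ω m k ≤ C * growth ω l k := by
  obtain ⟨K, hK, hA'⟩ := hω.mul_le A (by linarith)
  refine ⟨l * K, Real.exp (l * K), by positivity, Real.exp_pos _, fun m hm k hk => ?_⟩
  have key : ∀ r, 1 ≤ r → r ^ k * Real.exp (-(m * ω r)) ≤
      Real.exp (l * K) * growth ω l k / A ^ k := by
    intro r hr
    have h1 := hk.le (r := A * r) (by nlinarith)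
    have h0 := hω.nonneg r (by linarith)
    have h2 : -(m * ω r) ≤ l * K + -(l * ω (A * r)) := by
      have : l * ω (A * r) ≤ l * (K * (1 + ω r)) := by gcongr; exact hA' r (by linarith)
      nlinarith [mul_le_mul_of_nonneg_right hm h0]
    rw [le_div_iff₀ (by positivity)]
    calc r ^ k * Real.exp (-(m * ω r)) * A ^ k
        ≤ r ^ k * Real.exp (l * K + -(l * ω (A * r))) * A ^ k := by gcongr
      _ = Real.exp (l * K) * ((A * r) ^ k * Real.exp (-(l * ω (A * r)))) := by
        rw [Real.exp_add, mul_pow]; ring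
      _ ≤ _ := by gcongr
  refine ⟨.intro key, ?_⟩
  rw [mul_comm, ← le_div_iff₀ (by positivity)]
  exact growth_le key

/-- Since `ω(t) = o(t)`, the growth sequence dominates every sequence `k! A ^ k`. -/
theorem exists_factorial_mul_le_growth (hω : IsWeight ω) {A : ℝ} (hA : 1 ≤ A) (hl : 0 < l) :
    ∃ C : ℝ, 0 < C ∧ ∀ k, GrowthFinite ω l k → (k.factorial : ℝ) * A ^ k ≤ C * growth ω l k := by
  set ε : ℝ := Real.exp (-1) / (l * A) with hε
  have hεp : 0 < ε := by positivity
  obtain ⟨C, hC, h⟩ := hω.le_mul_add ε hεp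
  refine ⟨Real.exp (l * (ε + C)), by positivity, fun k hk => ?_⟩
  rcases Nat.eq_zero_or_pos k with rfl | hkp
  · have h1 := hk.exp_le
    simp only [Nat.factorial_zero, Nat.cast_one, pow_zero, mul_one]
    calc (1 : ℝ) = Real.exp (l * (ε + C)) * Real.exp (-(l * (ε + C))) := by
          rw [← Real.exp_add]; simp
      _ ≤ Real.exp (l * (ε + C)) * Real.exp (-(l * ω 1)) := by
          have := h 1 zero_le_one
          rw [mul_one] at this
          gcongr
      _ ≤ _ := by gcongr
  · -- the supremum is tested at the maximum point of `r ^ k * exp(-l ε r)`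
    set r : ℝ := k * A * Real.exp 1 with hr
    have hk1 : (1 : ℝ) ≤ k := by exact_mod_cast hkp
    have he : (1 : ℝ) ≤ Real.exp 1 := Real.one_le_exp zero_le_one
    have hr1 : 1 ≤ r := by
      rw [hr]; nlinarith [mul_le_mul hk1 hA zero_le_one (by linarith)]
    have hlr : l * (ε * r) = k := by
      have h3 : Real.exp (-1) * Real.exp 1 = 1 := by rw [← Real.exp_add]; simp
      have h4 : l * (ε * r) = k * (Real.exp (-1) * Real.exp 1) := by
        rw [hε, hr]; field_simp
      rw [h4, h3, mul_one]
    have h1 := hk.le hr1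
    have h2 := h r (by linarith)
    calc (k.factorial : ℝ) * A ^ k ≤ (k : ℝ) ^ k * A ^ k := by
          gcongr; exact_mod_cast Nat.factorial_le_pow k
      _ = r ^ k * Real.exp (-(k : ℝ)) := by
          rw [hr, mul_pow, mul_pow, ← Real.exp_nat_mul, mul_assoc ((k : ℝ) ^ k * A ^ k),
            ← Real.exp_add]
          simp
      _ = Real.exp (l * C) * (r ^ k * Real.exp (-(l * (ε * r + C)))) := by
          have : Real.exp (-(l * (ε * r + C))) = Real.exp (-(k : ℝ)) * Real.exp (-(l * C)) := by
            rw [← Real.exp_add, ← hlr]; ring_nf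
          rw [this]
          have h5 : Real.exp (l * C) * Real.exp (-(l * C)) = 1 := by rw [← Real.exp_add]; simp
          linear_combination (-(r ^ k * Real.exp (-(k : ℝ)))) * h5
      _ ≤ Real.exp (l * (ε + C)) * (r ^ k * Real.exp (-(l * ω r))) := by
          gcongr
          linarith
      _ ≤ _ := by gcongr

/-- The biconjugate theorem for the convex function `t ↦ ω(e^t)`, restricted to integer slopes. The
rounding of the slope costs the factor `R`. -/
theorem exists_growth_le (hω : IsWeight ω) (hm : 0 ≤ m) {R : ℝ} (hR : 1 ≤ R) :
    ∃ q : ℕ, GrowthFinite ω m q ∧ growth ω m q ≤ R ^ (q + 1) * Real.exp (-(m * ω R)) := by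
  have hR0 : 0 < R := by linarith
  set t₀ := Real.log R with ht₀
  have ht₀' : 0 ≤ t₀ := Real.log_nonneg hR
  have het : Real.exp t₀ = R := Real.exp_log hR0
  obtain ⟨s, hs0, hs⟩ : ∃ s : ℝ, 0 ≤ s ∧ ∀ t, ω (Real.exp t₀) + s * (t - t₀) ≤ ω (Real.exp t) := by
    refine ⟨derivWithin (fun t : ℝ => ω (Real.exp t)) (Set.Ioi t₀) t₀, ?_, fun t => ?_⟩
    · refine MonotoneOn.derivWithin_nonneg fun x hx y hy hxy => ?_
      exact hω.monotoneOn (Set.mem_Ici.2 (Real.exp_pos _).le) (Set.mem_Ici.2 (Real.exp_pos _).le)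
        (Real.exp_le_exp.2 hxy)
    · have hcv : ConvexOn ℝ Set.univ (fun t : ℝ => ω (Real.exp t)) := hω.delta
      have hint : t₀ ∈ interior (Set.univ : Set ℝ) := by simp
      rcases lt_trichotomy t t₀ with h | rfl | h
      · have h1 := (hcv.slope_le_leftDeriv_of_mem_interior (Set.mem_univ t) hint h).trans
          (hcv.leftDeriv_le_rightDeriv_of_mem_interior hint)
        rw [slope_def_field, div_le_iff₀ (by linarith)] at h1
        linarith
      · simp
      · have h1 := hcv.rightDeriv_le_slope_of_mem_interior hint (Set.mem_univ t) h
        rw [slope_def_field, le_div_iff₀ (by linarith)] at h1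
        linarith
  have key : ∀ r, 1 ≤ r → r ^ ⌊m * s⌋₊ * Real.exp (-(m * ω r)) ≤
      R ^ (⌊m * s⌋₊ + 1) * Real.exp (-(m * ω R)) := by
    intro r hr
    have hr0 : 0 < r := by linarith
    have ht : 0 ≤ Real.log r := Real.log_nonneg hr
    have h1 := hs (Real.log r)
    rw [Real.exp_log hr0, het] at h1
    have h2 : (⌊m * s⌋₊ : ℝ) ≤ m * s := Nat.floor_le (by positivity)
    have h3 : m * s ≤ ⌊m * s⌋₊ + 1 := (Nat.lt_floor_add_one _).le
    have e1 : r ^ ⌊m * s⌋₊ = Real.exp (⌊m * s⌋₊ * Real.log r) := by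
      rw [Real.exp_nat_mul, Real.exp_log hr0]
    have e2 : R ^ (⌊m * s⌋₊ + 1) = Real.exp ((⌊m * s⌋₊ + 1) * t₀) := by
      have := Real.exp_nat_mul t₀ (⌊m * s⌋₊ + 1)
      rw [het] at this
      rw [← this]; push_cast; rfl
    rw [e1, e2, ← Real.exp_add, ← Real.exp_add, Real.exp_le_exp]
    nlinarith [mul_le_mul_of_nonneg_left h1 hm, mul_le_mul_of_nonneg_right h2 ht,
      mul_le_mul_of_nonneg_right h3 ht₀']
  exact ⟨_, .intro key, growth_le key⟩

end growth

/-! ### Slowly increasing functions in terms of the growth sequence -/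

section youngConj

variable {ω : ℝ → ℝ} {m : ℝ} {k : ℕ}

theorem growth_term_eq (hm : 0 < m) (t : ℝ) : Real.exp t ^ k * Real.exp (-(m * ω (Real.exp t))) =
    Real.exp (m * (k / m * t - ω (Real.exp t))) := by
  rw [← Real.exp_nat_mul, ← Real.exp_add]
  congr 1
  field_simp
  ring

theorem growth_term_le_of_youngConj_le (hm : 0 < m) {y : ℝ} (hy : youngConj ω (k / m) ≤ y) :
    ∀ r, 1 ≤ r → r ^ k * Real.exp (-(m * ω r)) ≤ Real.exp (m * y) := by
  intro r hr
  have h := (le_iSup (fun t : {t : ℝ // 0 ≤ t} =>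
    (((k / m) * t.1 - ω (Real.exp t.1) : ℝ) : EReal)) ⟨Real.log r, Real.log_nonneg hr⟩).trans hy
  rw [EReal.coe_le_coe_iff] at h
  have h2 := growth_term_eq (ω := ω) (k := k) hm (Real.log r)
  rw [Real.exp_log (by linarith)] at h2 h
  rw [h2]
  gcongr

theorem GrowthFinite.youngConj_eq (hm : 0 < m) (h : GrowthFinite ω m k) :
    youngConj ω (k / m) = ((Real.log (growth ω m k) / m : ℝ) : EReal) := by
  apply le_antisymm
  · refine iSup_le fun t => ?_
    rw [EReal.coe_le_coe_iff, le_div_iff₀ hm, Real.le_log_iff_exp_le h.pos, mul_comm,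
      ← growth_term_eq hm]
    exact h.le (Real.one_le_exp t.2)
  · by_contra! hlt
    obtain ⟨z, hz1, hz2⟩ := EReal.lt_iff_exists_real_btwn.1 hlt
    have h1 := growth_le (growth_term_le_of_youngConj_le hm hz1.le)
    rw [EReal.coe_lt_coe_iff, lt_div_iff₀ hm, Real.lt_log_iff_exp_lt h.pos, mul_comm] at hz2
    linarith

theorem youngConj_eq_top (hm : 0 < m) (h : ¬ GrowthFinite ω m k) : youngConj ω (k / m) = ⊤ := by
  rw [EReal.eq_top_iff_forall_lt]
  intro y
  by_contra! hle
  exact h (.intro (growth_term_le_of_youngConj_le hm hle))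

end youngConj

theorem mem_OM_iff {N : ℕ} {ω : ℝ → ℝ} {f : Space N → ℂ} (hf : ContDiff ℝ (⊤ : ℕ∞) f) :
    f ∈ OM N ω ↔ ∀ m : ℕ, 1 ≤ m → ∃ C : ℝ, 0 < C ∧ ∃ n : ℕ, 1 ≤ n ∧ ∀ (α : Fin N → ℕ) (x : Space N),
      GrowthFinite ω m (mlen α) →
        ‖multiD α f x‖ ≤ C * Real.exp (n * ω ‖x‖) * growth ω m (mlen α) := by
  simp only [OM, Set.mem_ofPred_eq, hf, true_and]
  refine forall₂_congr fun m hm => exists_congr fun C => and_congr_right fun hC =>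
    exists_congr fun n => and_congr_right fun _ => forall₂_congr fun α x => ?_
  have hm0 : (0 : ℝ) < m := by exact_mod_cast hm
  by_cases hg : GrowthFinite ω m (mlen α)
  · have h1 : Real.exp (n * ω ‖x‖ + m * (Real.log (growth ω m (mlen α)) / m)) =
        Real.exp (n * ω ‖x‖) * growth ω m (mlen α) := by
      rw [mul_div_cancel₀ _ hm0.ne', Real.exp_add, Real.exp_log hg.pos]
    simp only [hg, forall_const]
    rw [hg.youngConj_eq hm0, ← EReal.coe_mul, ← EReal.coe_add, EReal.exp_coe,
      ← ENNReal.ofReal_mul hC.le, h1,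
      ENNReal.ofReal_le_ofReal_iff (by have := hg.pos; positivity), mul_assoc]
  · simp only [hg, false_imp_iff, iff_true]
    rw [youngConj_eq_top hm0 hg, EReal.coe_mul_top_of_pos hm0, EReal.coe_add_top, EReal.exp_top,
      ENNReal.mul_top (by simpa using hC)]
    exact le_top

/-! ### Partial derivatives -/

section partialD

variable {N : ℕ} {f g h : Space N → ℂ}

/-- `h` is an iterated directional derivative of `f` of order `n` along constant directions of norm
at most one. -/
def IsIteratedDirDeriv (n : ℕ) (f h : Space N → ℂ) : Prop :=
  ∃ v : Fin n → Space N, (∀ k, ‖v k‖ ≤ 1) ∧ ∀ x, h x = iteratedFDeriv ℝ n f x v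

theorem IsIteratedDirDeriv.partialD {n : ℕ} (hf : ContDiff ℝ (⊤ : ℕ∞) f)
    (hh : IsIteratedDirDeriv n f h) (i : Fin N) : IsIteratedDirDeriv (n + 1) f (partialD i h) := by
  obtain ⟨v, hv, hx⟩ := hh
  refine ⟨Fin.cons (EuclideanSpace.single i 1) v, fun k => ?_, fun x => ?_⟩
  · refine Fin.cases ?_ (fun k => ?_) k
    · simp
    · simpa using hv k
  · have hd : DifferentiableAt ℝ (iteratedFDeriv ℝ n f) x :=
      (hf.differentiable_iteratedFDeriv (by exact_mod_cast WithTop.coe_lt_top n)) x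
    rw [hd.iteratedFDeriv_succ_apply_left', Fin.tail_cons, Fin.cons_zero,
      BeurlingMultipliers.partialD, funext hx]

theorem isIteratedDirDeriv_multiD (hf : ContDiff ℝ (⊤ : ℕ∞) f) (α : Fin N → ℕ) :
    IsIteratedDirDeriv (mlen α) f (multiD α f) := by
  have h1 : ∀ (i : Fin N) (k n : ℕ) (h : Space N → ℂ), IsIteratedDirDeriv n f h →
      IsIteratedDirDeriv (k + n) f ((BeurlingMultipliers.partialD i)^[k] h) := by
    intro i k n h hh
    induction k with
    | zero => simpa using hh
    | succ k ih =>
      rw [Function.iterate_succ_apply', Nat.succ_add]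
      exact ih.partialD hf i
  have h2 : ∀ l : List (Fin N), IsIteratedDirDeriv (l.map α).sum f
      (l.foldr (fun i h => (BeurlingMultipliers.partialD i)^[α i] h) f) := by
    intro l
    induction l with
    | nil => exact ⟨Fin.elim0, fun k => k.elim0, fun x =>
      (iteratedFDeriv_zero_apply (𝕜 := ℝ) (f := f) (x := x) Fin.elim0).symm⟩
    | cons i l ih => simpa using h1 i (α i) _ _ ih
  have h3 : mlen α = ((List.finRange N).map α).sum := by
    rw [mlen, ← List.sum_ofFn, List.ofFn_eq_map]
  rw [h3]
  exact h2 _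

theorem norm_multiD_le (hf : ContDiff ℝ (⊤ : ℕ∞) f) (α : Fin N → ℕ) (x : Space N) :
    ‖multiD α f x‖ ≤ ‖iteratedFDeriv ℝ (mlen α) f x‖ := by
  obtain ⟨v, hv, hx⟩ := isIteratedDirDeriv_multiD hf α
  rw [hx]
  refine ((iteratedFDeriv ℝ (mlen α) f x).le_opNorm v).trans ?_
  exact mul_le_of_le_one_right (norm_nonneg _)
    (Finset.prod_le_one (fun k _ => norm_nonneg _) fun k _ => hv k)

theorem multiD_zero_index (f : Space N → ℂ) : multiD 0 f = f := by
  unfold multiD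
  induction List.finRange N with
  | nil => rfl
  | cons i l ih => simp

theorem mlen_zero : mlen (0 : Fin N → ℕ) = 0 := by simp [mlen]

theorem mlen_single (i : Fin N) (q : ℕ) : mlen (Pi.single i q) = q := by
  simp [mlen]

theorem multiD_single (i : Fin N) (q : ℕ) (f : Space N → ℂ) :
    multiD (Pi.single i q) f = (partialD i)^[q] f := by
  have key : ∀ l : List (Fin N), l.Nodup →
      l.foldr (fun j h => (partialD j)^[(Pi.single i q : Fin N → ℕ) j] h) f =
        if i ∈ l then (partialD i)^[q] f else f := by
    intro l hl
    induction l with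
    | nil => simp
    | cons j l ih =>
      rw [List.nodup_cons] at hl
      rw [List.foldr_cons, ih hl.2]
      rcases eq_or_ne j i with rfl | hne
      · simp [hl.1]
      · simp [hne, hne.symm]
  rw [multiD, key _ (List.nodup_finRange N), if_pos (List.mem_finRange i)]

/-- The line through `x` in the `i`-th coordinate direction. -/
def coordLine (i : Fin N) (x : Space N) (t : ℝ) : Space N := x + t • EuclideanSpace.single i 1

theorem contDiff_coordLine (i : Fin N) (x : Space N) :
    ContDiff ℝ (⊤ : ℕ∞) (coordLine i x) := by
  unfold coordLine
  fun_prop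

theorem hasLineDerivAt_partialD (i : Fin N) (hf : ContDiff ℝ (⊤ : ℕ∞) f) (x : Space N) :
    HasLineDerivAt ℝ f (partialD i f x) x (EuclideanSpace.single i 1) :=
  (hf.differentiable (by simp) x).hasFDerivAt.hasLineDerivAt _

theorem iteratedDeriv_comp_coordLine (i : Fin N) (hf : ContDiff ℝ (⊤ : ℕ∞) f) (x : Space N)
    (q : ℕ) : iteratedDeriv q (fun t => f (coordLine i x t)) =
      fun t => (partialD i)^[q] f (coordLine i x t) := by
  induction q with
  | zero => simp
  | succ q ih =>
    rw [iteratedDeriv_succ, ih]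
    funext t
    have hq := iter_partialD_contDiff i q hf
    have h1 := (hq.differentiable (by simp) (coordLine i x t)).hasFDerivAt
    have h2 : HasDerivAt (coordLine i x) (EuclideanSpace.single i 1) t := by
      unfold coordLine
      simpa using ((hasDerivAt_id t).smul_const (EuclideanSpace.single i (1 : ℝ))).const_add x
    rw [Function.iterate_succ_apply']
    exact (h1.comp_hasDerivAt t h2).deriv

/-- Leibniz' rule for the derivatives in one coordinate direction. -/
theorem norm_iter_partialD_mul_le (i : Fin N) (hf : ContDiff ℝ (⊤ : ℕ∞) f)
    (hg : ContDiff ℝ (⊤ : ℕ∞) g) (q : ℕ) (x : Space N) :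
    ‖(partialD i)^[q] (fun y => f y * g y) x‖ ≤ ∑ j ∈ Finset.range (q + 1),
      (q.choose j : ℝ) * ‖(partialD i)^[j] f x‖ * ‖(partialD i)^[q - j] g x‖ := by
  have h := norm_iteratedFDeriv_mul_le (hf.comp (contDiff_coordLine i x))
    (hg.comp (contDiff_coordLine i x)) 0 (n := q) (by exact_mod_cast le_top)
  have h0 : coordLine i x 0 = x := by simp [coordLine]
  have hfg := iteratedDeriv_comp_coordLine i (hf.mul hg) x q
  simp only [norm_iteratedFDeriv_eq_norm_iteratedDeriv, Function.comp_def] at h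
  rw [hfg] at h
  simp only [iteratedDeriv_comp_coordLine i hf, iteratedDeriv_comp_coordLine i hg, h0] at h
  exact h

theorem norm_iteratedFDeriv_le_of_analyticAt {E : Type*} [NormedAddCommGroup E] [NormedSpace ℝ E]
    {φ : E → ℂ} {x : E} (hφ : AnalyticAt ℝ φ x) : ∃ C A : ℝ, 0 < C ∧ 1 ≤ A ∧
      ∀ n, ‖iteratedFDeriv ℝ n φ x‖ ≤ C * (n.factorial * A ^ n) := by
  obtain ⟨p, r, hp⟩ := hφ
  obtain ⟨s, hs0, hs⟩ := ENNReal.lt_iff_exists_nnreal_btwn.1 hp.radius_pos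
  have hs0' : 0 < (s : ℝ) := by exact_mod_cast hs0
  obtain ⟨C, hC, hb⟩ := p.norm_mul_pow_le_of_lt_radius hs
  refine ⟨C, max 1 (s : ℝ)⁻¹, hC, le_max_left _ _, fun n => ?_⟩
  have hpn : ‖p n‖ ≤ C * (s : ℝ)⁻¹ ^ n := by
    rw [inv_pow, ← div_eq_mul_inv, le_div_iff₀ (by positivity)]
    exact hb n
  have h1 : ‖iteratedFDeriv ℝ n φ x‖ ≤ n.factorial * ‖p n‖ := by
    refine ContinuousMultilinearMap.opNorm_le_bound (by positivity) fun v => ?_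
    rw [hp.iteratedFDeriv_eq_sum_of_completeSpace]
    have h2 : ∀ σ : Equiv.Perm (Fin n), ‖p n (fun i => v (σ i))‖ ≤ ‖p n‖ * ∏ i, ‖v i‖ := by
      intro σ
      refine ((p n).le_opNorm _).trans_eq ?_
      rw [Equiv.prod_comp σ fun i => ‖v i‖]
    refine (norm_sum_le_of_le _ fun σ _ => h2 σ).trans_eq ?_
    simp [Fintype.card_perm, mul_assoc]
  calc _ ≤ _ := h1
    _ ≤ n.factorial * (C * max 1 (s : ℝ)⁻¹ ^ n) := by
      gcongr
      exact hpn.trans (by gcongr; exact le_max_right _ _)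
    _ = _ := by ring

end partialD

variable {N : ℕ} {ω : ℝ → ℝ}

/-! ### Fourier inversion and derivatives -/

theorem norm_fourier_le_integral_norm (f : Space N → ℂ) (w : Space N) :
    ‖𝓕 f w‖ ≤ ∫ v, ‖f v‖ :=
  VectorFourier.norm_fourierIntegral_le_integral_norm _ _ _ _ _

theorem norm_fourier_comp_sub (f : Space N → ℂ) (x w : Space N) :
    ‖𝓕 (fun v => f (v - x)) w‖ = ‖𝓕 f w‖ := by
  have h := congrFun (VectorFourier.fourierIntegral_comp_add_right Real.fourierChar volume
    (innerₗ (Space N)) f (-x)) w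
  simp only [Function.comp_def, ← sub_eq_add_neg] at h
  change ‖VectorFourier.fourierIntegral Real.fourierChar volume (innerₗ (Space N)) _ w‖ = _
  rw [h, Circle.norm_smul]
  rfl

theorem integral_fourier_mul (f g : Space N → ℂ) (hf : Integrable f) (hg : Integrable g) :
    ∫ ξ, 𝓕 f ξ * g ξ = ∫ x, f x * 𝓕 g x := by
  have h := VectorFourier.integral_fourierIntegral_smul_eq_flip (L := innerₗ (Space N))
    (μ := volume) (ν := volume) Real.continuous_fourierChar continuous_inner hf hg
  rw [flip_innerₗ] at h
  exact h

theorem eq_fourier_fourier_neg {f : Space N → ℂ} (hc : Continuous f) (hf : Integrable f)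
    (h'f : Integrable (𝓕 f)) : f = 𝓕 (fun ξ => 𝓕 f (-ξ)) := by
  rw [← Real.fourierInv_eq_fourier_comp_neg]
  exact (hc.fourierInv_fourier_eq hf h'f).symm

theorem norm_iteratedFDeriv_le_integral_fourier {f : Space N → ℂ} (hc : Continuous f)
    (hf : Integrable f) {n : ℕ} (h : ∀ k ≤ n, Integrable fun ξ => ‖ξ‖ ^ k * ‖𝓕 f ξ‖)
    (h'f : Integrable (𝓕 f)) (x : Space N) :
    ‖iteratedFDeriv ℝ n f x‖ ≤ (2 * Real.pi) ^ n * ∫ ξ, ‖ξ‖ ^ n * ‖𝓕 f ξ‖ := by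
  have hneg : ∀ k ≤ n, Integrable fun ξ => ‖ξ‖ ^ k * ‖𝓕 f (-ξ)‖ := fun k hk => by
    simpa using (h k hk).comp_neg
  have key := Real.iteratedFDeriv_fourier (f := fun ξ => 𝓕 f (-ξ)) (N := (n : ℕ∞))
    (fun k hk => hneg k (by exact_mod_cast hk)) h'f.comp_neg.aestronglyMeasurable le_rfl
  rw [eq_fourier_fourier_neg hc hf h'f, key, ← eq_fourier_fourier_neg hc hf h'f]
  refine (VectorFourier.norm_fourierIntegral_le_integral_norm _ _ _ _ _).trans ?_
  rw [← integral_const_mul]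
  rw [← integral_neg_eq_self]
  refine integral_mono_of_nonneg (Eventually.of_forall fun _ => norm_nonneg _)
    ((h n le_rfl).const_mul _) (Eventually.of_forall fun ξ => ?_)
  refine (VectorFourier.norm_fourierPowSMulRight_le _ _ _ _).trans ?_
  simp only [norm_neg, neg_neg]
  rw [mul_assoc]
  have h2 : 2 * Real.pi * ‖innerSL ℝ (E := Space N)‖ ≤ 2 * Real.pi :=
    mul_le_of_le_one_right (by positivity) (norm_innerSL_le ℝ)
  gcongr

theorem contDiff_of_fourier_moments {f : Space N → ℂ} (hc : Continuous f) (hf : Integrable f)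
    (h : ∀ k : ℕ, Integrable fun ξ => ‖ξ‖ ^ k * ‖𝓕 f ξ‖) (h'f : Integrable (𝓕 f)) :
    ContDiff ℝ (⊤ : ℕ∞) f := by
  rw [eq_fourier_fourier_neg hc hf h'f]
  refine Real.contDiff_fourier fun k _ => ?_
  simpa using (h k).comp_neg

/-! ### The Gaussian window -/

/-- The Gaussian `exp(-π |y|²)`, normalized so that it is its own Fourier transform. -/
def gauss (N : ℕ) : Space N → ℂ := fun y => Complex.exp (-(Real.pi : ℂ) * ‖y‖ ^ 2)

/-- The product of `f` with the Gaussian centred at `x`. Its Fourier transform, as a function of `x`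
and of the frequency, is the short-time Fourier transform of `f`. -/
def windowed (f : Space N → ℂ) (x : Space N) : Space N → ℂ := fun y => f y * gauss N (y - x)

theorem norm_gauss (y : Space N) : ‖gauss N y‖ = Real.exp (-(Real.pi * ‖y‖ ^ 2)) := by
  rw [gauss, Complex.norm_exp]
  congr 1
  have : (-(Real.pi : ℂ) * ‖y‖ ^ 2) = ((-(Real.pi * ‖y‖ ^ 2) : ℝ) : ℂ) := by push_cast; ring
  rw [this, Complex.ofReal_re]

theorem contDiff_gauss {n : WithTop ℕ∞} : ContDiff ℝ n (gauss N) := by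
  have h1 : ContDiff ℝ n fun y : Space N => (((-Real.pi) * ‖y‖ ^ 2 : ℝ) : ℂ) :=
    Complex.ofRealCLM.contDiff.comp (contDiff_const.mul (contDiff_norm_sq ℝ))
  have h2 : gauss N = fun y : Space N => Complex.exp (((-Real.pi) * ‖y‖ ^ 2 : ℝ) : ℂ) := by
    funext y; rw [gauss]; push_cast; rfl
  rw [h2]
  exact h1.cexp

theorem continuous_gauss : Continuous (gauss N) := (contDiff_gauss (n := 0)).continuous

theorem gauss_ne_zero (y : Space N) : gauss N y ≠ 0 := Complex.exp_ne_zero _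

theorem fourier_gauss : 𝓕 (gauss N) = gauss N := by
  funext w
  have h := fourier_gaussian_innerProductSpace (V := Space N) (b := (Real.pi : ℂ))
    (by simpa using Real.pi_pos) w
  have hpi : (Real.pi : ℂ) ≠ 0 := by exact_mod_cast Real.pi_ne_zero
  rw [div_self hpi, Complex.one_cpow, one_mul] at h
  have h2 : -(Real.pi : ℂ) ^ 2 * ‖w‖ ^ 2 / Real.pi = -(Real.pi : ℂ) * ‖w‖ ^ 2 := by
    field_simp
  rw [h2] at h
  exact h

theorem exists_norm_gauss_le (hω : IsWeight ω) {l : ℝ} (hl : 0 ≤ l) : ∃ C : ℝ, 0 < C ∧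
    ∀ y : Space N, ‖gauss N y‖ ≤ C * Real.exp (-(l * ω ‖y‖)) := by
  obtain ⟨C, hC, h⟩ := hω.exp_mul_gaussian_le l Real.pi hl Real.pi_pos
  refine ⟨C, hC, fun y => ?_⟩
  rw [norm_gauss, Real.exp_neg (l * _), ← div_eq_mul_inv, le_div_iff₀ (Real.exp_pos _), mul_comm]
  exact h _ (norm_nonneg y)

theorem integrable_of_norm_le_exp {f : Space N → ℂ} {c C : ℝ}
    (hc : Integrable fun x : Space N => Real.exp (-(c * ω ‖x‖)))
    (hf : AEStronglyMeasurable f) (h : ∀ x, ‖f x‖ ≤ C * Real.exp (-(c * ω ‖x‖))) :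
    Integrable f :=
  (hc.const_mul C).mono' hf (Eventually.of_forall h)

theorem integrable_gauss (hω : IsWeight ω) : Integrable (gauss N) := by
  obtain ⟨c, hc, hi⟩ := hω.integrable_exp_neg N
  obtain ⟨C, -, h⟩ := exists_norm_gauss_le (N := N) hω hc.le
  exact integrable_of_norm_le_exp hi continuous_gauss.aestronglyMeasurable h

theorem norm_gauss_sub_comm (x y : Space N) : ‖gauss N (x - y)‖ = ‖gauss N (y - x)‖ := by
  rw [norm_gauss, norm_gauss, norm_sub_rev]

theorem exists_exp_mul_gauss_le (hω : IsWeight ω) {l c : ℝ} (hl : 0 ≤ l) (hc : 0 ≤ c) :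
    ∃ L C : ℝ, 0 < C ∧ l ≤ L ∧ ∀ x y : Space N,
      Real.exp (l * ω ‖y‖) * ‖gauss N (y - x)‖ ≤
        C * Real.exp (L * ω ‖x‖) * Real.exp (-(c * ω ‖y - x‖)) := by
  obtain ⟨K, hK, hadd⟩ := hω.add_le
  obtain ⟨C, hC, h⟩ := exists_norm_gauss_le (N := N) hω (l := l * K + c) (by positivity)
  refine ⟨l * K, Real.exp (l * K) * C, by positivity, by nlinarith, fun x y => ?_⟩
  have h1 : ω ‖y‖ ≤ K * (1 + ω ‖x‖ + ω ‖y - x‖) := by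
    refine le_trans ?_ (hadd _ _ (norm_nonneg x) (norm_nonneg (y - x)))
    refine hω.monotoneOn (norm_nonneg y) (add_nonneg (norm_nonneg x) (norm_nonneg (y - x))) ?_
    simpa using norm_add_le x (y - x)
  calc Real.exp (l * ω ‖y‖) * ‖gauss N (y - x)‖
      ≤ Real.exp (l * (K * (1 + ω ‖x‖ + ω ‖y - x‖))) *
          (C * Real.exp (-((l * K + c) * ω ‖y - x‖))) := by gcongr; exact h _
    _ = C * (Real.exp (l * (K * (1 + ω ‖x‖ + ω ‖y - x‖))) *
          Real.exp (-((l * K + c) * ω ‖y - x‖))) := by ring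
    _ = C * (Real.exp (l * K) * Real.exp (l * K * ω ‖x‖) * Real.exp (-(c * ω ‖y - x‖))) := by
        rw [← Real.exp_add, ← Real.exp_add, ← Real.exp_add]; ring_nf
    _ = _ := by ring

theorem exists_integral_exp_mul_gauss_le (hω : IsWeight ω) (N : ℕ) {l : ℝ} (hl : 0 ≤ l) :
    ∃ m C : ℝ, 0 < m ∧ 0 < C ∧ ∀ x : Space N,
      Integrable (fun y : Space N => Real.exp (-(m * ω ‖y‖)) * ‖gauss N (y - x)‖) ∧
      ∫ y : Space N, Real.exp (-(m * ω ‖y‖)) * ‖gauss N (y - x)‖ ≤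
        C * Real.exp (-(l * ω ‖x‖)) := by
  obtain ⟨c, hc, hi⟩ := hω.integrable_exp_neg N
  obtain ⟨L, C, hC, hlL, h⟩ := exists_exp_mul_gauss_le (N := N) hω hl hc.le
  have hI : 0 ≤ ∫ x : Space N, Real.exp (-(c * ω ‖x‖)) :=
    integral_nonneg fun _ => (Real.exp_pos _).le
  have key : ∀ x y : Space N, Real.exp (-((L + 1) * ω ‖y‖)) * ‖gauss N (y - x)‖ ≤
      C * Real.exp (-(l * ω ‖x‖)) * Real.exp (-(c * ω ‖y - x‖)) := by
    intro x y
    have h1 := h y x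
    rw [norm_sub_rev x y, norm_gauss_sub_comm] at h1
    have h0 := hω.nonneg ‖y‖ (norm_nonneg y)
    calc Real.exp (-((L + 1) * ω ‖y‖)) * ‖gauss N (y - x)‖
        ≤ Real.exp (-(L * ω ‖y‖)) * ‖gauss N (y - x)‖ := by gcongr; linarith
      _ = Real.exp (-(L * ω ‖y‖)) * Real.exp (-(l * ω ‖x‖)) *
          (Real.exp (l * ω ‖x‖) * ‖gauss N (y - x)‖) := by
        have : Real.exp (-(l * ω ‖x‖)) * Real.exp (l * ω ‖x‖) = 1 := by
          rw [← Real.exp_add]; simp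
        linear_combination (-Real.exp (-(L * ω ‖y‖)) * ‖gauss N (y - x)‖) * this
      _ ≤ Real.exp (-(L * ω ‖y‖)) * Real.exp (-(l * ω ‖x‖)) *
          (C * Real.exp (L * ω ‖y‖) * Real.exp (-(c * ω ‖y - x‖))) := by gcongr
      _ = _ := by
        have : Real.exp (-(L * ω ‖y‖)) * Real.exp (L * ω ‖y‖) = 1 := by
          rw [← Real.exp_add]; simp
        linear_combination (Real.exp (-(l * ω ‖x‖)) * C * Real.exp (-(c * ω ‖y - x‖))) * this
  refine ⟨L + 1, C * (∫ x : Space N, Real.exp (-(c * ω ‖x‖))) + C, by linarith, by positivity,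
    fun x => ?_⟩
  have hi' := (hi.comp_sub_right x).const_mul (C * Real.exp (-(l * ω ‖x‖)))
  have hmeas : Continuous fun y : Space N => Real.exp (-((L + 1) * ω ‖y‖)) * ‖gauss N (y - x)‖ := by
    have h1 := hω.continuous_comp_norm (E := Space N)
    have h2 : Continuous fun y : Space N => gauss N (y - x) :=
      continuous_gauss.comp (continuous_sub_right x)
    exact (Real.continuous_exp.comp (h1.const_mul _).neg).mul h2.norm
  have hint : Integrable fun y : Space N => Real.exp (-((L + 1) * ω ‖y‖)) * ‖gauss N (y - x)‖ :=
    hi'.mono' hmeas.aestronglyMeasurable (Eventually.of_forall fun y => by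
      rw [Real.norm_of_nonneg (by positivity)]
      exact key x y)
  refine ⟨hint, (integral_mono hint hi' (key x)).trans ?_⟩
  rw [integral_const_mul, integral_sub_right_eq_self (fun y : Space N => Real.exp (-(c * ω ‖y‖)))]
  nlinarith [mul_pos hC (Real.exp_pos (-(l * ω ‖x‖)))]

/-! ### Decay in time and frequency controls all derivatives -/

/-- The bound `|h| ≤ P exp(-l ω)`. -/
def Decay (ω : ℝ → ℝ) (l P : ℝ) (h : Space N → ℂ) : Prop :=
  ∀ x, ‖h x‖ ≤ P * Real.exp (-(l * ω ‖x‖))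

namespace Decay

variable {l m P Q : ℝ} {h : Space N → ℂ}

theorem nonneg (hd : Decay ω l P h) : 0 ≤ P :=
  nonneg_of_mul_nonneg_left ((norm_nonneg _).trans (hd 0)) (Real.exp_pos _)

theorem mono (hω : IsWeight ω) (hd : Decay ω m P h) (hlm : l ≤ m) (hPQ : P ≤ Q) :
    Decay ω l Q h := fun x => (hd x).trans <| by
  have := hω.nonneg ‖x‖ (norm_nonneg x)
  have := hd.nonneg
  have := this.trans hPQ
  gcongr

theorem integrable (hd : Decay ω l P h) (hm : AEStronglyMeasurable h)
    (hl : Integrable fun x : Space N => Real.exp (-(l * ω ‖x‖))) : Integrable h :=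
  integrable_of_norm_le_exp hl hm hd

theorem weightedBdd (hd : Decay ω l P h) : WeightedBdd ω l h := by
  refine ⟨P, ?_⟩
  rintro _ ⟨x, rfl⟩
  have := hd x
  rw [Real.exp_neg, ← div_eq_mul_inv, le_div_iff₀ (Real.exp_pos _)] at this
  linarith

theorem weightedSup_le (hd : Decay ω l P h) : weightedSup ω l h ≤ P := by
  refine ciSup_le fun x => ?_
  have := hd x
  rw [Real.exp_neg, ← div_eq_mul_inv, le_div_iff₀ (Real.exp_pos _)] at this
  linarith

end Decay

theorem WeightedBdd.decay {l : ℝ} {h : Space N → ℂ} (hb : WeightedBdd ω l h) :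
    Decay ω l (weightedSup ω l h) h := by
  intro x
  rw [Real.exp_neg, ← div_eq_mul_inv, le_div_iff₀ (Real.exp_pos _), mul_comm]
  exact hb.le x

theorem weightedSup_nonneg (l : ℝ) (h : Space N → ℂ) : 0 ≤ weightedSup ω l h :=
  Real.iSup_nonneg fun _ => by positivity

theorem exists_growthFinite (hω : IsWeight ω) (k : ℕ) :
    ∃ l₀ : ℝ, 0 < l₀ ∧ ∀ l, l₀ ≤ l → GrowthFinite ω l k := by
  obtain ⟨c, C, hc, hC, h⟩ := hω.one_add_le_exp
  refine ⟨(k + 1) * c, by positivity, fun l hl => .intro (B := C ^ k) fun r hr => ?_⟩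
  have h0 := hω.nonneg r (by linarith)
  calc r ^ k * Real.exp (-(l * ω r))
      ≤ (C * Real.exp (c * ω r)) ^ k * Real.exp (-(k * c * ω r)) := by
        have := h r (by linarith)
        gcongr
        · linarith
        · nlinarith
    _ = C ^ k := by
        rw [mul_pow, ← Real.exp_nat_mul, mul_assoc, ← Real.exp_add]
        ring_nf
        simp

theorem pow_norm_mul_le (hω : IsWeight ω) {l c D : ℝ} {k : ℕ} {u : Space N → ℂ} (hl : 0 ≤ l)
    (hk : GrowthFinite ω l k) (hu : Decay ω (l + c) D u) (ξ : Space N) :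
    ‖ξ‖ ^ k * ‖u ξ‖ ≤
      D * Real.exp (l * ω 1) * growth ω l k * Real.exp (-(c * ω ‖ξ‖)) := by
  have hD := hu.nonneg
  have hpos := hk.pos
  have h1 : 0 ≤ l * ω 1 := mul_nonneg hl (hω.nonneg 1 zero_le_one)
  have key : ‖ξ‖ ^ k * Real.exp (-(l * ω ‖ξ‖)) ≤ Real.exp (l * ω 1) * growth ω l k := by
    rcases le_total 1 ‖ξ‖ with h | h
    · exact (hk.le h).trans (le_mul_of_one_le_left hpos.le (Real.one_le_exp h1))
    · calc ‖ξ‖ ^ k * Real.exp (-(l * ω ‖ξ‖)) ≤ 1 * 1 := by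
            gcongr
            · exact pow_le_one₀ (norm_nonneg _) h
            · rw [Real.exp_le_one_iff]
              nlinarith [mul_nonneg hl (hω.nonneg ‖ξ‖ (norm_nonneg _))]
        _ = Real.exp (l * ω 1) * Real.exp (-(l * ω 1)) := by rw [← Real.exp_add]; simp
        _ ≤ _ := by gcongr; exact hk.exp_le
  calc ‖ξ‖ ^ k * ‖u ξ‖ ≤ ‖ξ‖ ^ k * (D * Real.exp (-((l + c) * ω ‖ξ‖))) := by gcongr; exact hu ξ
    _ = D * (‖ξ‖ ^ k * Real.exp (-(l * ω ‖ξ‖))) * Real.exp (-(c * ω ‖ξ‖)) := by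
      have : Real.exp (-((l + c) * ω ‖ξ‖)) =
          Real.exp (-(l * ω ‖ξ‖)) * Real.exp (-(c * ω ‖ξ‖)) := by
        rw [← Real.exp_add]; ring_nf
      rw [this]; ring
    _ ≤ D * (Real.exp (l * ω 1) * growth ω l k) * Real.exp (-(c * ω ‖ξ‖)) := by gcongr
    _ = _ := by ring

theorem continuous_fourier {f : Space N → ℂ} (hf : Integrable f) : Continuous (𝓕 f) :=
  VectorFourier.fourierIntegral_continuous Real.continuous_fourierChar
    (L := innerₗ (Space N)) continuous_inner hf

theorem contDiff_windowed {f : Space N → ℂ} {n : WithTop ℕ∞} (hf : ContDiff ℝ n f) (x : Space N) :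
    ContDiff ℝ n (windowed f x) :=
  hf.mul (contDiff_gauss.comp (contDiff_id.sub contDiff_const))

theorem analyticAt_inv_gauss (x : Space N) : AnalyticAt ℝ (fun y => (gauss N y)⁻¹) x :=
  (contDiff_gauss (n := ⊤)).contDiffAt.analyticAt.inv (gauss_ne_zero x)

/-- If the Fourier transform of `f`, cut off by a Gaussian centred at `x`, decays like
`exp(-L ω)`, then the derivatives of `f` at `x` are bounded by the growth sequence: the derivatives
of the cut-off function are estimated by Fourier inversion, and those of the inverse of the Gaussian
grow like factorials, which the growth sequence dominates. -/
theorem exists_iteratedFDeriv_le_of_windowed (hω : IsWeight ω) (N : ℕ) {l : ℝ} (hl : 0 < l) :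
    ∃ L C : ℝ, 0 < L ∧ 0 < C ∧ ∀ f : Space N → ℂ, ContDiff ℝ (⊤ : ℕ∞) f → ∀ (x : Space N) (D : ℝ),
      Integrable (windowed f x) → Decay ω L D (𝓕 (windowed f x)) → ∀ n, GrowthFinite ω l n →
        ‖iteratedFDeriv ℝ n f x‖ ≤ C * D * growth ω l n := by
  obtain ⟨c, hc, hci⟩ := hω.integrable_exp_neg N
  have hpi := Real.pi_gt_three
  obtain ⟨m, C₁, hm, hC₁, habs⟩ :=
    exists_pow_mul_growth_le hω (A := 2 * (2 * Real.pi)) (by linarith) hl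
  obtain ⟨C₂, A, hC₂, hA, hinv⟩ := norm_iteratedFDeriv_le_of_analyticAt
    (analyticAt_inv_gauss (0 : Space N))
  obtain ⟨C₃, hC₃, hfac⟩ := exists_factorial_mul_le_growth hω hA hm
  set I : ℝ := ∫ ξ : Space N, Real.exp (-(c * ω ‖ξ‖)) with hI
  have hI0 : 0 ≤ I := integral_nonneg fun _ => (Real.exp_pos _).le
  set M : ℝ := Real.exp (m * ω 1) with hM
  have hM0 : 0 < M := Real.exp_pos _
  refine ⟨m + c, M * (I + 1) * C₂ * C₃ * C₁, by positivity, by positivity,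
    fun f hf x D hi hd n hn => ?_⟩
  have hD := hd.nonneg
  obtain ⟨hmn, habs'⟩ := habs m le_rfl n hn
  have hF := contDiff_windowed hf x
  have hFc := hF.continuous
  have hu := continuous_fourier hi
  -- the derivatives of the cut-off function
  have hmom : ∀ k ≤ n, Integrable fun ξ => ‖ξ‖ ^ k * ‖𝓕 (windowed f x) ξ‖ := by
    intro k hk
    refine (hci.const_mul (D * M * growth ω m k)).mono' ?_ (Eventually.of_forall fun ξ => ?_)
    · exact ((continuous_norm.pow k).mul hu.norm).aestronglyMeasurable
    · rw [Real.norm_of_nonneg (by positivity)]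
      exact pow_norm_mul_le hω hm.le (hmn.of_le hk) hd ξ
  have hui : Integrable (𝓕 (windowed f x)) := by
    have := hmom 0 (Nat.zero_le n)
    simp only [pow_zero, one_mul] at this
    exact (integrable_norm_iff hu.aestronglyMeasurable).1 this
  have hFk : ∀ k ≤ n, ‖iteratedFDeriv ℝ k (windowed f x) x‖ ≤
      (2 * Real.pi) ^ n * (D * M * I) * growth ω m k := by
    intro k hk
    have hpos := (hmn.of_le hk).pos
    refine (norm_iteratedFDeriv_le_integral_fourier hFc hi (fun j hj => hmom j (hj.trans hk))
      hui x).trans ?_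
    have h1 : ∫ ξ, ‖ξ‖ ^ k * ‖𝓕 (windowed f x) ξ‖ ≤ D * M * growth ω m k * I := by
      rw [hI, ← integral_const_mul]
      exact integral_mono (hmom k hk) (hci.const_mul _)
        (pow_norm_mul_le hω hm.le (hmn.of_le hk) hd)
    calc (2 * Real.pi) ^ k * ∫ ξ, ‖ξ‖ ^ k * ‖𝓕 (windowed f x) ξ‖
        ≤ (2 * Real.pi) ^ n * (D * M * growth ω m k * I) := by
          gcongr
          linarith
      _ = _ := by ring
  -- the derivatives of the inverse of the Gaussian
  set E : Space N → ℂ := fun y => (gauss N (y - x))⁻¹ with hE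
  have hEc : ContDiff ℝ (⊤ : ℕ∞) E :=
    (contDiff_gauss.comp (contDiff_id.sub contDiff_const)).inv fun y => gauss_ne_zero _
  have hEk : ∀ k ≤ n, ‖iteratedFDeriv ℝ k E x‖ ≤ C₂ * C₃ * growth ω m k := by
    intro k hk
    have h1 : iteratedFDeriv ℝ k E x = iteratedFDeriv ℝ k (fun y => (gauss N y)⁻¹) 0 := by
      have := iteratedFDeriv_comp_sub (𝕜 := ℝ) (f := fun y : Space N => (gauss N y)⁻¹) k x x
      rw [sub_self] at this
      exact this
    rw [h1, mul_assoc]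
    refine (hinv k).trans ?_
    exact mul_le_mul_of_nonneg_left (hfac k (hmn.of_le hk)) hC₂.le
  have hfE : f = fun y => windowed f x y * E y := by
    funext y
    simp only [windowed, hE]
    rw [mul_assoc, mul_inv_cancel₀ (gauss_ne_zero _), mul_one]
  have hleib := norm_iteratedFDeriv_mul_le hF hEc x (n := n) (by exact_mod_cast le_top)
  rw [← hfE] at hleib
  have hterm : ∀ k ∈ Finset.range (n + 1), (n.choose k : ℝ) *
      ‖iteratedFDeriv ℝ k (windowed f x) x‖ * ‖iteratedFDeriv ℝ (n - k) E x‖ ≤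
      (n.choose k : ℝ) * ((2 * Real.pi) ^ n * (D * M * I) * (C₂ * C₃) * growth ω m n) := by
    intro k hk
    have hk' : k ≤ n := Nat.lt_succ_iff.1 (Finset.mem_range.1 hk)
    have hg := GrowthFinite.mul_le (j := k) (k := n - k) hω hm.le
      (by rwa [Nat.add_sub_cancel' hk'])
    rw [Nat.add_sub_cancel' hk'] at hg
    have hp1 := (hmn.of_le hk').pos
    have hp2 := (hmn.of_le (Nat.sub_le n k)).pos
    calc _ ≤ (n.choose k : ℝ) * ((2 * Real.pi) ^ n * (D * M * I) * growth ω m k) *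
          (C₂ * C₃ * growth ω m (n - k)) := by
          gcongr
          · exact hFk k hk'
          · exact hEk _ (Nat.sub_le n k)
      _ = (n.choose k : ℝ) * ((2 * Real.pi) ^ n * (D * M * I) * (C₂ * C₃) *
          (growth ω m k * growth ω m (n - k))) := by ring
      _ ≤ _ := by gcongr
  refine hleib.trans ((Finset.sum_le_sum hterm).trans ?_)
  have hsum : ∑ k ∈ Finset.range (n + 1), (n.choose k : ℝ) = 2 ^ n := by
    exact_mod_cast Nat.sum_range_choose n
  rw [← Finset.sum_mul, hsum]
  have hgp := hn.pos
  have hgp' := hmn.pos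
  calc (2 : ℝ) ^ n * ((2 * Real.pi) ^ n * (D * M * I) * (C₂ * C₃) * growth ω m n)
      = D * M * I * (C₂ * C₃) * ((2 * (2 * Real.pi)) ^ n * growth ω m n) := by
        rw [mul_pow 2 (2 * Real.pi) n]; ring
    _ ≤ D * M * (I + 1) * (C₂ * C₃) * (C₁ * growth ω l n) := by
        gcongr ?_ * ?_
        gcongr
        linarith
    _ = _ := by ring

theorem norm_fourier_windowed_le_time {h : Space N → ℂ} (x ξ : Space N) :
    ‖𝓕 (windowed h x) ξ‖ ≤ ∫ y, ‖h y‖ * ‖gauss N (y - x)‖ := by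
  refine (norm_fourier_le_integral_norm _ _).trans_eq ?_
  simp [windowed]

theorem norm_fourier_windowed_le_frequency (hω : IsWeight ω) {h : Space N → ℂ}
    (hc : Continuous h) (hi : Integrable h) (hi' : Integrable (𝓕 h)) (x ξ : Space N) :
    ‖𝓕 (windowed h x) ξ‖ ≤ ∫ η, ‖𝓕 h η‖ * ‖gauss N (η - ξ)‖ := by
  set G : Space N → ℂ := fun v => Real.fourierChar (-inner ℝ v ξ) • gauss N (v - x) with hG
  have hGi : Integrable G := by
    have h1 := (integrable_gauss (N := N) hω).comp_sub_right x
    exact (Real.fourierIntegral_convergent_iff ξ).2 h1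
  have h1 : 𝓕 (windowed h x) ξ = ∫ v, 𝓕 (fun η => 𝓕 h (-η)) v * G v := by
    rw [← eq_fourier_fourier_neg hc hi hi', Real.fourier_eq]
    congr 1
    funext v
    simp only [windowed, hG, Circle.smul_def, smul_eq_mul]
    ring
  have hFG : ∀ η, ‖𝓕 G η‖ = ‖gauss N (η + ξ)‖ := by
    intro η
    have h2 : 𝓕 G η = 𝓕 (fun v => gauss N (v - x)) (η + ξ) := by
      rw [Real.fourier_eq, Real.fourier_eq]
      congr 1
      funext v
      rw [hG, smul_smul, ← AddChar.map_add_eq_mul, inner_add_right, neg_add]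
    rw [h2, norm_fourier_comp_sub, fourier_gauss]
  rw [h1, integral_fourier_mul _ _ hi'.comp_neg hGi]
  refine (norm_integral_le_integral_norm _).trans_eq ?_
  rw [← integral_neg_eq_self]
  congr 1
  funext η
  rw [norm_mul, hFG, neg_neg, neg_add_eq_sub, norm_gauss_sub_comm]

/-- The short-time Fourier transform of `h` decays in time because `h` does, and in frequency
because `𝓕 h` does. The geometric mean of the two bounds gives decay in both variables at once, so
that all derivatives of `h` decay and obey the growth sequence. -/
theorem exists_iteratedFDeriv_le_of_decay (hω : IsWeight ω) (N : ℕ) {l m : ℝ} (hl : 0 < l)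
    (hm : 0 ≤ m) : ∃ L C : ℝ, 0 < L ∧ 0 < C ∧ ∀ h : Space N → ℂ, ContDiff ℝ (⊤ : ℕ∞) h → ∀ P : ℝ,
      Decay ω L P h → Decay ω L P (𝓕 h) → ∀ n, GrowthFinite ω l n → ∀ x,
        ‖iteratedFDeriv ℝ n h x‖ ≤ C * P * Real.exp (-(m * ω ‖x‖)) * growth ω l n := by
  obtain ⟨c, hc, hci⟩ := hω.integrable_exp_neg N
  obtain ⟨L₁, C₁, hL₁, hC₁, hA⟩ := exists_iteratedFDeriv_le_of_windowed hω N hl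
  obtain ⟨L₂, C₂, hL₂, hC₂, hB⟩ := exists_integral_exp_mul_gauss_le hω N
    (l := 2 * (m + L₁)) (by positivity)
  refine ⟨max L₂ c, C₁ * C₂, by positivity, by positivity, fun h hh P hd hd' n hn x => ?_⟩
  have hP := hd.nonneg
  have hcL := hω.integrable_exp_neg_of_le (le_max_right L₂ c) hci
  have hi : Integrable h := hd.integrable hh.continuous.aestronglyMeasurable hcL
  have hi' : Integrable (𝓕 h) :=
    hd'.integrable (continuous_fourier hi).aestronglyMeasurable hcL
  have hint : ∀ u : Space N → ℂ, Decay ω (max L₂ c) P u → ∀ x,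
      ∫ y, ‖u y‖ * ‖gauss N (y - x)‖ ≤ P * (C₂ * Real.exp (-(2 * (m + L₁) * ω ‖x‖))) := by
    intro u hu x
    obtain ⟨hi1, hi2⟩ := hB x
    refine le_trans ?_ (mul_le_mul_of_nonneg_left hi2 hP)
    rw [← integral_const_mul]
    refine integral_mono_of_nonneg (Eventually.of_forall fun _ => by positivity)
      (hi1.const_mul P) (Eventually.of_forall fun y => ?_)
    have := hu.mono hω (le_max_left L₂ c) le_rfl y
    calc ‖u y‖ * ‖gauss N (y - x)‖ ≤ (P * Real.exp (-(L₂ * ω ‖y‖))) * ‖gauss N (y - x)‖ := by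
          gcongr
      _ = _ := by ring
  have hwin : Integrable (windowed h x) :=
    hi.mul_bdd (c := 1)
      (continuous_gauss.comp (continuous_sub_right x)).aestronglyMeasurable
      (Eventually.of_forall fun y => by
        rw [norm_gauss, Real.exp_le_one_iff, neg_nonpos]
        positivity)
  have hdec : Decay ω L₁ (P * C₂ * Real.exp (-(m * ω ‖x‖))) (𝓕 (windowed h x)) := by
    intro ξ
    have h1 := (norm_fourier_windowed_le_time x ξ).trans (hint h hd x)
    have h2 := (norm_fourier_windowed_le_frequency hω hh.continuous hi hi' x ξ).trans
      (hint _ hd' ξ)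
    have hx := hω.nonneg ‖x‖ (norm_nonneg x)
    have hξ := hω.nonneg ‖ξ‖ (norm_nonneg ξ)
    rw [mul_assoc (P * C₂), ← Real.exp_add, mul_assoc P]
    rcases le_total (ω ‖x‖) (ω ‖ξ‖) with hle | hle
    · refine h2.trans ?_
      gcongr
      nlinarith [mul_nonneg hm hξ, mul_nonneg hL₁.le hξ, mul_le_mul_of_nonneg_left hle hm,
        mul_le_mul_of_nonneg_left hle hL₁.le]
    · refine h1.trans ?_
      gcongr
      nlinarith [mul_nonneg hm hx, mul_nonneg hL₁.le hx, mul_le_mul_of_nonneg_left hle hm,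
        mul_le_mul_of_nonneg_left hle hL₁.le]
  refine (hA h hh x _ hwin hdec n hn).trans_eq ?_
  ring

/-! ### The Fourier transform in the two normalizations -/

theorem fourierT_eq (f : Space N → ℂ) (ξ : Space N) :
    fourierT f ξ = 𝓕 f ((2 * Real.pi)⁻¹ • ξ) := by
  rw [Real.fourier_eq', fourierT]
  congr 1
  funext x
  rw [smul_eq_mul, mul_comm, inner_smul_right]
  congr 2
  have : (-2 * Real.pi * ((2 * Real.pi)⁻¹ * inner ℝ x ξ)) = -(inner ℝ x ξ) := by
    have := Real.pi_ne_zero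
    field_simp
  rw [this]
  push_cast
  ring

theorem fourier_eq_fourierT (f : Space N → ℂ) (w : Space N) :
    𝓕 f w = fourierT f ((2 * Real.pi) • w) := by
  rw [fourierT_eq, smul_smul, inv_mul_cancel₀ (by have := Real.pi_ne_zero; positivity), one_smul]

theorem Decay.fourier_of_fourierT (hω : IsWeight ω) {l P : ℝ} (hl : 0 ≤ l) {h : Space N → ℂ}
    (hd : Decay ω l P (fourierT h)) : Decay ω l P (𝓕 h) := by
  intro w
  rw [fourier_eq_fourierT]
  refine (hd _).trans ?_
  have hP := hd.nonneg
  have hpi := Real.pi_gt_three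
  have : ω ‖w‖ ≤ ω ‖(2 * Real.pi) • w‖ := by
    refine hω.monotoneOn (norm_nonneg _) (norm_nonneg _) ?_
    rw [norm_smul, Real.norm_of_nonneg (by positivity)]
    nlinarith [norm_nonneg w]
  gcongr

theorem exists_decay_fourierT (hω : IsWeight ω) (N : ℕ) {l : ℝ} (hl : 0 ≤ l) : ∃ m C : ℝ,
    l ≤ m ∧ 0 < C ∧ ∀ (h : Space N → ℂ) (P : ℝ), Decay ω m P (𝓕 h) →
      Decay ω l (C * P) (fourierT h) := by
  have hpi := Real.pi_gt_three
  obtain ⟨K, hK, hmul⟩ := hω.mul_le (2 * Real.pi) (by positivity)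
  refine ⟨l * K, Real.exp (l * K), by nlinarith, Real.exp_pos _, fun h P hd ξ => ?_⟩
  rw [fourierT_eq]
  refine (hd _).trans ?_
  have hP := hd.nonneg
  have h1 := hmul ‖(2 * Real.pi)⁻¹ • ξ‖ (norm_nonneg _)
  have h2 : 2 * Real.pi * ‖(2 * Real.pi)⁻¹ • ξ‖ = ‖ξ‖ := by
    rw [norm_smul, Real.norm_of_nonneg (by positivity), ← mul_assoc,
      mul_inv_cancel₀ (by positivity), one_mul]
  rw [h2] at h1
  rw [mul_comm (Real.exp (l * K)) P, mul_assoc P, ← Real.exp_add]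
  gcongr
  nlinarith [mul_le_mul_of_nonneg_left h1 hl]

theorem fourierT_fourierT {h : Space N → ℂ} (hc : Continuous h) (hi : Integrable h)
    (hi' : Integrable (𝓕 h)) (x : Space N) :
    fourierT (fourierT h) x = ((2 * Real.pi) ^ N : ℝ) * h (-x) := by
  have hpi := Real.pi_pos
  have h1 := Measure.integral_comp_inv_smul (μ := (volume : Measure (Space N)))
    (fun η => 𝓕 h η * Complex.exp (-(Complex.I * ((inner ℝ ((2 * Real.pi) • η) x : ℝ) : ℂ))))
    (2 * Real.pi)
  have h2 : fourierT (fourierT h) x = ∫ ξ : Space N, 𝓕 h ((2 * Real.pi)⁻¹ • ξ) *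
      Complex.exp (-(Complex.I * ((inner ℝ ((2 * Real.pi) • (2 * Real.pi)⁻¹ • ξ) x : ℝ) : ℂ))) := by
    rw [fourierT]
    congr 1
    funext ξ
    rw [fourierT_eq, smul_smul, mul_inv_cancel₀ (by positivity), one_smul]
  have h3 : 𝓕 (𝓕 h) x = h (-x) := by
    have := congrFun (hc.fourierInv_fourier_eq hi hi') (-x)
    rw [Real.fourierInv_eq_fourier_neg, neg_neg] at this
    exact this
  rw [h2, h1, ← h3, Real.fourier_eq', finrank_euclideanSpace_fin,
    abs_of_pos (by positivity), Complex.real_smul]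
  congr 2
  funext η
  rw [smul_eq_mul, mul_comm, inner_smul_left]
  congr 2
  simp
  ring

/-! ### Membership in `S_ω` from decay in time and frequency -/

theorem integrable_of_decay (hω : IsWeight ω) {h : Space N → ℂ} (hm : AEStronglyMeasurable h)
    (hd : ∀ l : ℝ, 0 < l → ∃ P, Decay ω l P h) : Integrable h := by
  obtain ⟨c, hc, hci⟩ := hω.integrable_exp_neg N
  obtain ⟨P, hP⟩ := hd c hc
  exact hP.integrable hm hci

theorem integrable_pow_mul_of_decay (hω : IsWeight ω) {h : Space N → ℂ} (hm : Continuous h)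
    (hd : ∀ l : ℝ, 0 < l → ∃ P, Decay ω l P h) (k : ℕ) :
    Integrable fun x => ‖x‖ ^ k * ‖h x‖ := by
  obtain ⟨c, hc, hci⟩ := hω.integrable_exp_neg N
  obtain ⟨l, hl, hk⟩ := exists_growthFinite hω k
  obtain ⟨P, hP⟩ := hd (l + c) (by positivity)
  refine (hci.const_mul (P * Real.exp (l * ω 1) * growth ω l k)).mono'
    ((continuous_norm.pow k).mul hm.norm).aestronglyMeasurable (Eventually.of_forall fun x => ?_)
  rw [Real.norm_of_nonneg (by positivity)]
  exact pow_norm_mul_le hω hl.le (hk l le_rfl) hP x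

theorem contDiff_fourierT {h : Space N → ℂ} (hh : ContDiff ℝ (⊤ : ℕ∞) (𝓕 h)) :
    ContDiff ℝ (⊤ : ℕ∞) (fourierT h) := by
  rw [funext (fourierT_eq h)]
  exact hh.comp (contDiff_const_smul _)

theorem exists_decay_multiD (hω : IsWeight ω) {l : ℝ} (hl : 0 ≤ l) (α : Fin N → ℕ) :
    ∃ L C : ℝ, 0 < L ∧ 0 < C ∧ ∀ h : Space N → ℂ, ContDiff ℝ (⊤ : ℕ∞) h →
      ContDiff ℝ (⊤ : ℕ∞) (fourierT h) → ∀ P, Decay ω L P h → Decay ω L P (fourierT h) →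
        Decay ω l (C * P) (multiD α h) ∧ Decay ω l (C * P) (multiD α (fourierT h)) := by
  obtain ⟨c, hc, hci⟩ := hω.integrable_exp_neg N
  obtain ⟨l', hl', hk⟩ := exists_growthFinite hω (mlen α)
  have hg := hk l' le_rfl
  obtain ⟨L, C, hL, hC, hB⟩ := exists_iteratedFDeriv_le_of_decay hω N hl' hl
  set T : ℝ := (2 * Real.pi) ^ N with hT
  have hT1 : 1 ≤ T := one_le_pow₀ (by linarith [Real.pi_gt_three])
  refine ⟨max L c, C * T * growth ω l' (mlen α), by positivity, by have := hg.pos; positivity,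
    fun h hh hh' P hd hd' => ?_⟩
  have hP := hd.nonneg
  have hcL := hω.integrable_exp_neg_of_le (le_max_right L c) hci
  have hi : Integrable h := hd.integrable hh.continuous.aestronglyMeasurable hcL
  have hdF : Decay ω (max L c) P (𝓕 h) := hd'.fourier_of_fourierT hω (by positivity)
  have hi' : Integrable (𝓕 h) :=
    hdF.integrable (continuous_fourier hi).aestronglyMeasurable hcL
  have hPT : P ≤ T * P := le_mul_of_one_le_left hP hT1
  have key : ∀ u : Space N → ℂ, ContDiff ℝ (⊤ : ℕ∞) u → Decay ω L (T * P) u →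
      Decay ω L (T * P) (𝓕 u) →
      Decay ω l (C * T * growth ω l' (mlen α) * P) (multiD α u) := by
    intro u hu hu1 hu2 x
    refine (norm_multiD_le hu α x).trans ((hB u hu (T * P) hu1 hu2 _ hg x).trans_eq ?_)
    ring
  refine ⟨key h hh (hd.mono hω (le_max_left _ _) hPT) (hdF.mono hω (le_max_left _ _) hPT),
    key _ hh' (hd'.mono hω (le_max_left _ _) hPT) (Decay.fourier_of_fourierT hω hL.le fun x => ?_)⟩
  rw [fourierT_fourierT hh.continuous hi hi', norm_mul, Complex.norm_real,
    Real.norm_of_nonneg (by positivity), mul_assoc]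
  have := hd.mono hω (le_max_left L c) le_rfl (-x)
  rw [norm_neg] at this
  gcongr

theorem memS_of_decay (hω : IsWeight ω) {h : Space N → ℂ} (hc : Continuous h)
    (hd : ∀ l : ℝ, 0 < l → ∃ P, Decay ω l P h) (hd' : ∀ l : ℝ, 0 < l → ∃ P, Decay ω l P (𝓕 h)) :
    MemS N ω h := by
  have hi := integrable_of_decay hω hc.aestronglyMeasurable hd
  have hFc := continuous_fourier hi
  have hi' := integrable_of_decay hω hFc.aestronglyMeasurable hd'
  have hh : ContDiff ℝ (⊤ : ℕ∞) h :=
    contDiff_of_fourier_moments hc hi (integrable_pow_mul_of_decay hω hFc hd') hi'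
  have hh' : ContDiff ℝ (⊤ : ℕ∞) (fourierT h) := contDiff_fourierT
    (Real.contDiff_fourier fun k _ => integrable_pow_mul_of_decay hω hc hd k)
  have key : ∀ l : ℝ, 0 < l → ∀ α : Fin N → ℕ, WeightedBdd ω l (multiD α h) ∧
      WeightedBdd ω l (multiD α (fourierT h)) := by
    intro l hl α
    obtain ⟨L, C, hL, -, hLC⟩ := exists_decay_multiD hω hl.le α
    obtain ⟨m, C', hLm, hC', hm⟩ := exists_decay_fourierT hω N hL.le
    obtain ⟨P, hP⟩ := hd L hL
    obtain ⟨Q, hQ⟩ := hd' m (hL.trans_le hLm)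
    have h1 := hP.mono hω le_rfl (le_max_left P (C' * Q))
    have h2 := (hm h Q hQ).mono hω le_rfl (le_max_right P (C' * Q))
    obtain ⟨h3, h4⟩ := hLC h hh hh' _ h1 h2
    exact ⟨h3.weightedBdd, h4.weightedBdd⟩
  exact ⟨hi, hh, hh', fun l hl α => (key l hl α).1, fun l hl α => (key l hl α).2⟩

namespace MemS

variable {g : Space N → ℂ}

theorem decay (hg : MemS N ω g) {l : ℝ} (hl : 0 < l) : Decay ω l (weightedSup ω l g) g := by
  have := hg.bdd l hl 0
  rw [multiD_zero_index] at this
  exact this.decay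

theorem decay_fourierT (hg : MemS N ω g) {l : ℝ} (hl : 0 < l) :
    Decay ω l (weightedSup ω l (fourierT g)) (fourierT g) := by
  have := hg.bdd_fourier l hl 0
  rw [multiD_zero_index] at this
  exact this.decay

end MemS

/-! ### Multiplication by a slowly increasing function -/

theorem fourier_partialD (i : Fin N) {h : Space N → ℂ} (hh : ContDiff ℝ (⊤ : ℕ∞) h)
    (hi : Integrable h) (hi' : Integrable (partialD i h)) (ξ : Space N) :
    𝓕 (partialD i h) ξ = (2 * Real.pi * Complex.I * ξ i) * 𝓕 h ξ := by
  set e : Space N → ℂ := fun x => Complex.exp (↑(-2 * Real.pi * inner ℝ x ξ) * Complex.I) with he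
  have he1 : ∀ x, ‖e x‖ = 1 := fun x => Complex.norm_exp_ofReal_mul_I _
  have hec : Continuous e := by
    rw [he]; fun_prop
  have hde : ∀ x, HasLineDerivAt ℝ e (-(2 * Real.pi * Complex.I * ξ i) * e x) x
      (EuclideanSpace.single i 1) := by
    intro x
    have h1 : HasDerivAt (fun t : ℝ => -2 * Real.pi * inner ℝ (x + t • EuclideanSpace.single i 1) ξ)
        (-2 * Real.pi * ξ i) 0 := by
      have h2 : (fun t : ℝ => -2 * Real.pi * inner ℝ (x + t • EuclideanSpace.single i (1 : ℝ)) ξ) =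
          fun t : ℝ => -2 * Real.pi * inner ℝ x ξ + t * (-2 * Real.pi * ξ i) := by
        funext t
        rw [inner_add_left, inner_smul_left, EuclideanSpace.inner_single_left]
        simp
        ring
      rw [h2]
      simpa using ((hasDerivAt_id (0 : ℝ)).mul_const (-2 * Real.pi * ξ i)).const_add
        (-2 * Real.pi * inner ℝ x ξ)
    have h3 := (h1.ofReal_comp.mul_const Complex.I).cexp
    rw [HasLineDerivAt]
    refine h3.congr_deriv ?_
    simp only [he, zero_smul, add_zero]
    push_cast
    ring
  have hB : ∀ {u : Space N → ℂ}, Integrable u → Integrable fun x => e x * u x := fun hu =>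
    hu.bdd_mul hec.aestronglyMeasurable (c := 1) (Eventually.of_forall fun x => (he1 x).le)
  have key := integral_bilinear_hasLineDerivAt_right_eq_neg_left_of_integrable
    (μ := (volume : Measure (Space N))) (B := ContinuousLinearMap.mul ℝ ℂ)
    (f := e) (f' := fun x => -(2 * Real.pi * Complex.I * ξ i) * e x) (g := h) (g' := partialD i h)
    (v := EuclideanSpace.single i 1)
    (by simpa only [ContinuousLinearMap.mul_apply', mul_assoc] using (hB hi).const_mul _)
    (hB hi') (hB hi) (fun x _ => hde x) (fun x _ => hasLineDerivAt_partialD i hh x)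
  simp only [ContinuousLinearMap.mul_apply', mul_assoc] at key
  rw [Real.fourier_eq', Real.fourier_eq']
  simp only [smul_eq_mul]
  rw [key, integral_const_mul]
  ring

theorem fourier_iter_partialD (i : Fin N) {h : Space N → ℂ} (hh : ContDiff ℝ (⊤ : ℕ∞) h) (q : ℕ)
    (hi : ∀ j ≤ q, Integrable ((partialD i)^[j] h)) (ξ : Space N) :
    𝓕 ((partialD i)^[q] h) ξ = (2 * Real.pi * Complex.I * ξ i) ^ q * 𝓕 h ξ := by
  induction q with
  | zero => simp
  | succ q ih =>
    have h1 := hi (q + 1) le_rfl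
    rw [Function.iterate_succ_apply'] at h1 ⊢
    rw [fourier_partialD i (iter_partialD_contDiff i q hh) (hi q q.le_succ) h1,
      ih fun j hj => hi j (hj.trans q.le_succ)]
    ring

theorem norm_le_sum_abs (ξ : Space N) : ‖ξ‖ ≤ ∑ i, |ξ i| := by
  rw [EuclideanSpace.norm_eq, Real.sqrt_le_left (Finset.sum_nonneg fun i _ => abs_nonneg _)]
  simp only [Real.norm_eq_abs]
  exact Finset.sum_sq_le_sq_sum_of_nonneg fun i _ => abs_nonneg _

theorem exists_norm_le_mul_abs {ξ : Space N} (hξ : 0 < ‖ξ‖) : ∃ i, ‖ξ‖ ≤ N * |ξ i| := by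
  have hN : 0 < N := by
    rcases Nat.eq_zero_or_pos N with rfl | h
    · simp [Subsingleton.elim ξ 0] at hξ
    · exact h
  have hne : (Finset.univ : Finset (Fin N)).Nonempty := ⟨⟨0, hN⟩, Finset.mem_univ _⟩
  have hN' : (0 : ℝ) < N := by exact_mod_cast hN
  obtain ⟨i, -, hi⟩ := Finset.exists_le_of_sum_le (s := Finset.univ) (f := fun _ : Fin N => ‖ξ‖ / N)
    (g := fun i => |ξ i|) hne (by
      rw [Finset.sum_const, Finset.card_univ, Fintype.card_fin, nsmul_eq_mul,
        mul_div_cancel₀ _ hN'.ne']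
      exact norm_le_sum_abs ξ)
  exact ⟨i, by rwa [div_le_iff₀ hN', mul_comm] at hi⟩

/-- The derivatives in a coordinate direction of `f g`, for slowly increasing `f`, are bounded by
the growth sequence. The constant depends on `g` only through a linear factor. -/
theorem exists_iter_partialD_mul_le (hω : IsWeight ω) {f : Space N → ℂ}
    (hf : ContDiff ℝ (⊤ : ℕ∞) f) (hO : f ∈ OM N ω) {m : ℕ} (hm : 1 ≤ m) {c : ℝ} (hc : 0 ≤ c) :
    ∃ L C : ℝ, 0 < L ∧ 0 < C ∧ ∀ g : Space N → ℂ, ContDiff ℝ (⊤ : ℕ∞) g → ∀ P,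
      Decay ω L P g → Decay ω L P (𝓕 g) → ∀ (i : Fin N) (q : ℕ), GrowthFinite ω m q →
        Decay ω c (C * P * 2 ^ q * growth ω m q) ((partialD i)^[q] fun x => f x * g x) := by
  have hm0 : (0 : ℝ) < m := by exact_mod_cast hm
  obtain ⟨C₁, hC₁, n, -, hO'⟩ := (mem_OM_iff hf).1 hO m hm
  obtain ⟨L, C₂, hL, hC₂, hB⟩ := exists_iteratedFDeriv_le_of_decay hω N hm0
    (m := n + c) (by positivity)
  refine ⟨L, C₁ * C₂, hL, by positivity, fun g hg P hd hd' i q hq x => ?_⟩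
  have hP := hd.nonneg
  refine (norm_iter_partialD_mul_le i hf hg q x).trans ?_
  have hterm : ∀ j ∈ Finset.range (q + 1), (q.choose j : ℝ) * ‖(partialD i)^[j] f x‖ *
      ‖(partialD i)^[q - j] g x‖ ≤ (q.choose j : ℝ) *
        (C₁ * C₂ * P * growth ω m q * Real.exp (-(c * ω ‖x‖))) := by
    intro j hj
    have hj' : j ≤ q := Nat.lt_succ_iff.1 (Finset.mem_range.1 hj)
    have hsub : j + (q - j) = q := Nat.add_sub_cancel' hj'
    have hgj := hq.of_le hj'
    have hgq := hq.of_le (Nat.sub_le q j)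
    have hmul := GrowthFinite.mul_le (j := j) (k := q - j) hω hm0.le (by rwa [hsub])
    rw [hsub] at hmul
    have h1 := hO' (Pi.single i j) x (by rwa [mlen_single])
    rw [multiD_single, mlen_single] at h1
    have h2 := (norm_multiD_le hg (Pi.single i (q - j)) x).trans (hB g hg P hd hd' _
      (by rwa [mlen_single]) x)
    rw [multiD_single, mlen_single] at h2
    have hp1 := hgj.pos
    have hp2 := hgq.pos
    calc (q.choose j : ℝ) * ‖(partialD i)^[j] f x‖ * ‖(partialD i)^[q - j] g x‖
        ≤ (q.choose j : ℝ) * (C₁ * Real.exp (n * ω ‖x‖) * growth ω m j) *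
          (C₂ * P * Real.exp (-((n + c) * ω ‖x‖)) * growth ω m (q - j)) := by gcongr
      _ = (q.choose j : ℝ) * (C₁ * C₂ * P * (growth ω m j * growth ω m (q - j)) *
          (Real.exp (n * ω ‖x‖) * Real.exp (-((n + c) * ω ‖x‖)))) := by ring
      _ = (q.choose j : ℝ) * (C₁ * C₂ * P * (growth ω m j * growth ω m (q - j)) *
          Real.exp (-(c * ω ‖x‖))) := by rw [← Real.exp_add]; ring_nf
      _ ≤ _ := by gcongr
  refine (Finset.sum_le_sum hterm).trans_eq ?_
  have hsum : ∑ k ∈ Finset.range (q + 1), (q.choose k : ℝ) = 2 ^ q := by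
    exact_mod_cast Nat.sum_range_choose q
  rw [← Finset.sum_mul, hsum]
  ring

/-- Multiplication by a slowly increasing function preserves decay in time and frequency. The decay
of the Fourier transform comes from the bounds for the derivatives in the coordinate direction in
which the frequency is largest, optimized over their order by means of `(δ)`. -/
theorem exists_decay_mul (hω : IsWeight ω) {f : Space N → ℂ} (hf : ContDiff ℝ (⊤ : ℕ∞) f)
    (hO : f ∈ OM N ω) {l : ℝ} (hl : 0 < l) :
    ∃ L C : ℝ, 0 < L ∧ 0 < C ∧ ∀ g : Space N → ℂ, ContDiff ℝ (⊤ : ℕ∞) g → ∀ P,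
      Decay ω L P g → Decay ω L P (𝓕 g) →
        Decay ω l (C * P) (fun x => f x * g x) ∧ Decay ω l (C * P) (𝓕 fun x => f x * g x) := by
  obtain ⟨c, hc, hci⟩ := hω.integrable_exp_neg N
  obtain ⟨K, hK, hmul⟩ := hω.mul_le N (Nat.cast_nonneg N)
  obtain ⟨c₁, C₁, hc₁, hC₁, hexp⟩ := hω.one_add_le_exp
  obtain ⟨m, hm⟩ := exists_nat_ge (l * K + c₁)
  have hm0 : (0 : ℝ) < m := lt_of_lt_of_le (by positivity) hm
  have hm1 : 1 ≤ m := by exact_mod_cast hm0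
  obtain ⟨L, C, hL, hC, hD⟩ := exists_iter_partialD_mul_le hω hf hO hm1 hc.le
  obtain ⟨C₀, hC₀, n₀, -, hO₀⟩ := (mem_OM_iff hf).1 hO 1 le_rfl
  set I : ℝ := ∫ ξ : Space N, Real.exp (-(c * ω ‖ξ‖)) with hI
  have hI0 : 0 ≤ I := integral_nonneg fun _ => (Real.exp_pos _).le
  have hN0 := hω.nonneg N (Nat.cast_nonneg N)
  have hgf : GrowthFinite ω (1 : ℕ) 0 := growthFinite_zero hω (by simp)
  set G : ℝ := growth ω (1 : ℕ) 0 with hG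
  have hG0 : 0 < G := hgf.pos
  -- `A` serves for the function, `B₁` for low and `B₂` for high frequencies
  set A : ℝ := C₀ * G with hA
  set B₁ : ℝ := A * I * Real.exp (l * ω N) with hB₁
  set B₂ : ℝ := C * I * C₁ * Real.exp (l * K) with hB₂
  have hA0 : 0 < A := by positivity
  have hB₁0 : 0 ≤ B₁ := by positivity
  have hB₂0 : 0 ≤ B₂ := by positivity
  refine ⟨max L (n₀ + l + c), A + B₁ + B₂, by positivity, by positivity,
    fun g hg P hd hd' => ?_⟩
  have hP := hd.nonneg
  have hfg : ContDiff ℝ (⊤ : ℕ∞) fun x => f x * g x := hf.mul hg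
  have htime : Decay ω (l + c) (A * P) fun x => f x * g x := by
    intro x
    have h1 := hO₀ 0 x (by rw [mlen_zero]; exact hgf)
    rw [multiD_zero_index, mlen_zero] at h1
    have h2 := hd.mono hω (le_max_right L (n₀ + l + c)) le_rfl x
    rw [norm_mul]
    calc ‖f x‖ * ‖g x‖ ≤ (C₀ * Real.exp (n₀ * ω ‖x‖) * G) *
          (P * Real.exp (-((n₀ + l + c) * ω ‖x‖))) := by gcongr
      _ = A * P * (Real.exp (n₀ * ω ‖x‖) * Real.exp (-((n₀ + l + c) * ω ‖x‖))) := by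
        rw [hA]; ring
      _ = _ := by rw [← Real.exp_add]; ring_nf
  have hle : ∀ {D : ℝ}, 0 ≤ D → D ≤ A + B₁ + B₂ → D * P ≤ (A + B₁ + B₂) * P :=
    fun _ h => mul_le_mul_of_nonneg_right h hP
  refine ⟨htime.mono hω (by linarith) (hle hA0.le (by linarith)), fun ξ => ?_⟩
  rcases le_or_gt ‖ξ‖ N with hξ | hξ
  · have h1 : ‖𝓕 (fun x => f x * g x) ξ‖ ≤ A * P * I := by
      refine (norm_fourier_le_integral_norm _ _).trans ?_
      rw [hI, ← integral_const_mul]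
      exact integral_mono_of_nonneg (Eventually.of_forall fun _ => norm_nonneg _)
        (hci.const_mul _) (Eventually.of_forall (htime.mono hω (by linarith) le_rfl))
    have h2 : 1 ≤ Real.exp (l * ω N) * Real.exp (-(l * ω ‖ξ‖)) := by
      rw [← Real.exp_add]
      refine Real.one_le_exp ?_
      have := hω.monotoneOn (norm_nonneg ξ) (Set.mem_Ici.2 (Nat.cast_nonneg N)) hξ
      nlinarith
    calc _ ≤ _ := h1
      _ ≤ A * P * I * (Real.exp (l * ω N) * Real.exp (-(l * ω ‖ξ‖))) :=
        le_mul_of_one_le_right (by positivity) h2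
      _ = B₁ * P * Real.exp (-(l * ω ‖ξ‖)) := by rw [hB₁]; ring
      _ ≤ _ := by gcongr ?_ * _; exact hle hB₁0 (by linarith)
  · obtain ⟨i, hi⟩ := exists_norm_le_mul_abs ((Nat.cast_nonneg N).trans_lt hξ)
    have hi1 : 1 < |ξ i| := by
      by_contra! h
      have : (N : ℝ) * |ξ i| ≤ N * 1 := by gcongr
      linarith
    set R : ℝ := Real.pi * |ξ i| with hR
    have hpi := Real.pi_gt_three
    have hξR : |ξ i| ≤ R := by nlinarith
    have hR1 : 1 ≤ R := hi1.le.trans hξR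
    have hR0 : 0 < R := by linarith
    obtain ⟨q, hq, hqR⟩ := exists_growth_le hω hm0.le hR1
    have hder := fun j (hj : j ≤ q) => hD g hg P (hd.mono hω (le_max_left _ _) le_rfl)
      (hd'.mono hω (le_max_left _ _) le_rfl) i j (hq.of_le hj)
    have hint : ∀ j ≤ q, Integrable ((partialD i)^[j] fun x => f x * g x) := fun j hj =>
      (hder j hj).integrable (iter_partialD_contDiff i j hfg).continuous.aestronglyMeasurable hci
    have h1 : (2 * R) ^ q * ‖𝓕 (fun x => f x * g x) ξ‖ ≤ C * P * 2 ^ q * growth ω m q * I := by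
      have h2 : ‖𝓕 ((partialD i)^[q] fun x => f x * g x) ξ‖ ≤ C * P * 2 ^ q * growth ω m q * I := by
        refine (norm_fourier_le_integral_norm _ _).trans ?_
        rw [hI, ← integral_const_mul]
        exact integral_mono_of_nonneg (Eventually.of_forall fun _ => norm_nonneg _)
          (hci.const_mul _) (Eventually.of_forall (hder q le_rfl))
      rw [fourier_iter_partialD i hfg q hint, norm_mul, norm_pow] at h2
      have h3 : ‖(2 * Real.pi * Complex.I * ξ i : ℂ)‖ = 2 * R := by
        simp [hR, abs_of_pos Real.pi_pos, mul_assoc]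
      rwa [h3] at h2
    have h4 : ‖𝓕 (fun x => f x * g x) ξ‖ ≤ C * P * I * (R * Real.exp (-(m * ω R))) := by
      have h5 : R ^ q * ‖𝓕 (fun x => f x * g x) ξ‖ ≤ C * P * I * growth ω m q := by
        rw [mul_pow] at h1
        have : (0 : ℝ) < 2 ^ q := by positivity
        nlinarith
      have h6 : R ^ q * ‖𝓕 (fun x => f x * g x) ξ‖ ≤
          R ^ q * (C * P * I * (R * Real.exp (-(m * ω R)))) := by
        refine h5.trans ((mul_le_mul_of_nonneg_left hqR (by positivity)).trans_eq ?_)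
        ring
      exact le_of_mul_le_mul_left h6 (by positivity)
    have hωR := hω.nonneg R hR0.le
    have h7 : ω ‖ξ‖ ≤ K * (1 + ω R) := by
      refine le_trans ?_ (hmul R hR0.le)
      refine hω.monotoneOn (norm_nonneg ξ) (Set.mem_Ici.2 (by positivity)) (hi.trans ?_)
      gcongr
    have h8 : R * Real.exp (-(m * ω R)) ≤ C₁ * Real.exp (l * K) * Real.exp (-(l * ω ‖ξ‖)) := by
      calc R * Real.exp (-(m * ω R)) ≤ C₁ * Real.exp (c₁ * ω R) * Real.exp (-(m * ω R)) := by
            gcongr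
            linarith [hexp R hR0.le]
        _ = C₁ * Real.exp (c₁ * ω R + -(m * ω R)) := by rw [Real.exp_add]; ring
        _ ≤ C₁ * Real.exp (l * K + -(l * ω ‖ξ‖)) := by
            gcongr ?_ * Real.exp ?_
            have := mul_le_mul_of_nonneg_left h7 hl.le
            have := mul_le_mul_of_nonneg_right hm hωR
            nlinarith
        _ = _ := by rw [Real.exp_add]; ring
    calc _ ≤ _ := h4
      _ ≤ C * P * I * (C₁ * Real.exp (l * K) * Real.exp (-(l * ω ‖ξ‖))) := by gcongr
      _ = B₂ * P * Real.exp (-(l * ω ‖ξ‖)) := by rw [hB₂]; ring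
      _ ≤ _ := by gcongr ?_ * _; exact hle hB₂0 (by linarith)

theorem MemS.mul_of_mem_OM (hω : IsWeight ω) {f g : Space N → ℂ} (hf : ContDiff ℝ (⊤ : ℕ∞) f)
    (hO : f ∈ OM N ω) (hg : MemS N ω g) : MemS N ω fun x => f x * g x := by
  have key : ∀ l : ℝ, 0 < l → ∃ P, Decay ω l P (fun x => f x * g x) ∧
      Decay ω l P (𝓕 fun x => f x * g x) := by
    intro l hl
    obtain ⟨L, C, hL, hC, h⟩ := exists_decay_mul hω hf hO hl
    exact ⟨_, h g hg.contDiff _ ((hg.decay hL).mono hω le_rfl (le_max_left _ _))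
      (((hg.decay_fourierT hL).fourier_of_fourierT hω hL.le).mono hω le_rfl (le_max_right _ _))⟩
  refine memS_of_decay hω (hf.mul hg.contDiff).continuous (fun l hl => ?_) fun l hl => ?_
  · obtain ⟨P, hP, -⟩ := key l hl
    exact ⟨P, hP⟩
  · obtain ⟨P, -, hP⟩ := key l hl
    exact ⟨P, hP⟩

theorem exists_seminormFamily_mul_le (hω : IsWeight ω) {f : Space N → ℂ}
    (hf : ContDiff ℝ (⊤ : ℕ∞) f) (hO : f ∈ OM N ω) (p : ℕ+ × (Fin N → ℕ)) :
    ∃ (n : ℕ+) (C : ℝ), 0 ≤ C ∧ ∀ g h : S N ω, h.toFun = (fun x => f x * g.toFun x) →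
      S.seminormFamily N ω p h ≤ C * S.seminormFamily N ω (n, 0) g := by
  obtain ⟨L₁, C₁, hL₁, hC₁, h1⟩ := exists_decay_multiD hω (N := N) (l := (p.1 : ℕ))
    (Nat.cast_nonneg _) p.2
  obtain ⟨L₂, C₂, hL₂, hC₂, h2⟩ := exists_decay_fourierT hω N hL₁.le
  obtain ⟨L₃, C₃, hL₃, hC₃, h3⟩ := exists_decay_mul hω hf hO (hL₁.trans_le hL₂)
  obtain ⟨n, hn⟩ := exists_nat_ge L₃
  have hn0 : (0 : ℝ) < n := hL₃.trans_le hn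
  set T : ℝ := (1 + C₂) * C₃ with hT
  have hT0 : 0 < T := by positivity
  refine ⟨⟨n, by exact_mod_cast hn0⟩, 2 * (C₁ * T), by positivity, fun g h hgh => ?_⟩
  set P : ℝ := weightedSup ω n g.toFun + weightedSup ω n (fourierT g.toFun) with hPdef
  have hgP : S.seminormFamily N ω (⟨n, by exact_mod_cast hn0⟩, 0) g = P := by
    change weightedSup ω n (multiD 0 g.toFun) + weightedSup ω n (multiD 0 (fourierT g.toFun)) = P
    rw [multiD_zero_index, multiD_zero_index]
  have hg := g.memS
  have w1 := weightedSup_nonneg (ω := ω) n g.toFun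
  have w2 := weightedSup_nonneg (ω := ω) n (fourierT g.toFun)
  have hd : Decay ω L₃ P g.toFun := (hg.decay hn0).mono hω hn (by linarith)
  have hd' : Decay ω L₃ P (𝓕 g.toFun) :=
    ((hg.decay_fourierT hn0).fourier_of_fourierT hω hn0.le).mono hω hn (by linarith)
  have hP := hd.nonneg
  obtain ⟨h4, h5⟩ := h3 g.toFun hg.contDiff P hd hd'
  rw [← hgh] at h4 h5
  have h6 := h4.mono (l := L₁) (Q := T * P) hω hL₂ (by
    rw [hT]; nlinarith [mul_nonneg (mul_nonneg hC₂.le hC₃.le) hP])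
  have h7 := (h2 _ _ h5).mono (l := L₁) (Q := T * P) hω le_rfl (by
    rw [hT]; nlinarith [mul_nonneg hC₃.le hP])
  obtain ⟨h8, h9⟩ := h1 h.toFun h.memS.contDiff h.memS.contDiff_fourier _ h6 h7
  rw [hgP]
  calc S.seminormFamily N ω p h ≤ C₁ * (T * P) + C₁ * (T * P) :=
        add_le_add h8.weightedSup_le h9.weightedSup_le
    _ = 2 * (C₁ * T) * P := by ring

theorem exists_multiplication_operator (hω : IsWeight ω) {f : Space N → ℂ}
    (hf : ContDiff ℝ (⊤ : ℕ∞) f) (hO : f ∈ OM N ω) :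
    ∃ M : S N ω →L[ℂ] S N ω, ∀ g x, (M g).toFun x = f x * g.toFun x := by
  let M : S N ω →ₗ[ℂ] S N ω :=
    { toFun := fun g => ⟨fun x => f x * g.toFun x, MemS.mul_of_mem_OM hω hf hO g.memS⟩
      map_add' := fun g h => Subtype.ext <| funext fun x => mul_add _ _ _
      map_smul' := fun c g => Subtype.ext <| funext fun x => mul_left_comm _ _ _ }
  refine ⟨⟨M, ?_⟩, fun g x => rfl⟩
  refine WithSeminorms.continuous_of_isBounded (S.withSeminorms N ω) (S.withSeminorms N ω) M
    fun p => ?_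
  obtain ⟨n, C, hC, h⟩ := exists_seminormFamily_mul_le hω hf hO p
  refine ⟨{(n, 0)}, ⟨C, hC⟩, fun g => ?_⟩
  rw [Finset.sup_singleton]
  exact h g (M g) rfl

/-! ### Superpositions of translated Gaussians -/

/-- The superposition `∑ b_j γ(· - x_j)` of translates of the Gaussian `γ`. -/
def gaussSum (x : ℕ → Space N) (b : ℕ → ℂ) : Space N → ℂ := fun y => ∑' j, b j * gauss N (y - x j)

section gaussSum

variable {x : ℕ → Space N} {a b : ℕ → ℂ}

theorem norm_gauss_le_one (y : Space N) : ‖gauss N y‖ ≤ 1 := by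
  rw [norm_gauss, Real.exp_le_one_iff, neg_nonpos]
  positivity

theorem norm_mul_gauss_le (z : ℂ) (y : Space N) : ‖z * gauss N y‖ ≤ ‖z‖ := by
  rw [norm_mul]
  exact mul_le_of_le_one_right (norm_nonneg _) (norm_gauss_le_one _)

theorem summable_mul_gauss (hb : Summable fun j => ‖b j‖) (y : Space N) :
    Summable fun j => b j * gauss N (y - x j) :=
  .of_norm_bounded hb fun _ => norm_mul_gauss_le _ _

theorem norm_gaussSum_le (hb : Summable fun j => ‖b j‖) (y : Space N) :
    ‖gaussSum x b y‖ ≤ ∑' j, ‖b j‖ :=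
  tsum_of_norm_bounded hb.hasSum fun _ => norm_mul_gauss_le _ _

theorem continuous_gaussSum (hb : Summable fun j => ‖b j‖) : Continuous (gaussSum x b) :=
  continuous_tsum (fun j => continuous_const.mul
    (continuous_gauss.comp (continuous_sub_right (x j)))) hb fun _ _ => norm_mul_gauss_le _ _

theorem gaussSum_add (ha : Summable fun j => ‖a j‖) (hb : Summable fun j => ‖b j‖) :
    gaussSum x (fun j => a j + b j) = gaussSum x a + gaussSum x b := by
  funext y
  simp only [gaussSum, Pi.add_apply, add_mul]
  exact (summable_mul_gauss ha y).tsum_add (summable_mul_gauss hb y)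

theorem gaussSum_smul (c : ℂ) : gaussSum x (fun j => c * b j) = c • gaussSum x b := by
  funext y
  simp only [gaussSum, Pi.smul_apply, smul_eq_mul, mul_assoc]
  exact tsum_mul_left

theorem fourier_gaussSum (hω : IsWeight ω) (hb : Summable fun j => ‖b j‖) (ξ : Space N) :
    𝓕 (gaussSum x b) ξ = ∑' j, b j * 𝓕 (fun y => gauss N (y - x j)) ξ := by
  have hint : ∀ j, Integrable fun y => gauss N (y - x j) := fun j =>
    (integrable_gauss hω).comp_sub_right (x j)
  have h1 : ∀ j, Integrable fun y => Real.fourierChar (-inner ℝ y ξ) • (b j * gauss N (y - x j)) :=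
    fun j => (Real.fourierIntegral_convergent_iff ξ).2 ((hint j).const_mul _)
  have h2 : Summable fun j =>
      ∫ y, ‖Real.fourierChar (-inner ℝ y ξ) • (b j * gauss N (y - x j))‖ := by
    simp only [Circle.norm_smul, norm_mul, integral_const_mul]
    have h3 : ∀ j, ∫ y, ‖gauss N (y - x j)‖ = ∫ y, ‖gauss N y‖ := fun j =>
      integral_sub_right_eq_self (fun y => ‖gauss N y‖) (x j)
    simp only [h3]
    exact hb.mul_right _
  have h3 := (hasSum_integral_of_summable_integral_norm h1 h2).tsum_eq
  rw [Real.fourier_eq]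
  have h4 : ∀ y, Real.fourierChar (-inner ℝ y ξ) • gaussSum x b y =
      ∑' j, Real.fourierChar (-inner ℝ y ξ) • (b j * gauss N (y - x j)) := by
    intro y
    simp only [gaussSum, Circle.smul_def, smul_eq_mul]
    exact tsum_mul_left.symm
  simp only [h4]
  rw [← h3]
  congr 1
  funext j
  rw [Real.fourier_eq, ← integral_const_mul]
  congr 1
  funext y
  simp only [Circle.smul_def, smul_eq_mul]
  ring

theorem memS_gaussSum (hω : IsWeight ω)
    (hb : ∀ l : ℝ, 0 < l → Summable fun j => ‖b j‖ * Real.exp (l * ω ‖x j‖)) :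
    MemS N ω (gaussSum x b) := by
  have hb0 : Summable fun j => ‖b j‖ := by
    refine .of_nonneg_of_le (fun j => norm_nonneg _) (fun j => ?_) (hb 1 one_pos)
    refine le_mul_of_one_le_right (norm_nonneg _) (Real.one_le_exp ?_)
    have := hω.nonneg _ (norm_nonneg (x j))
    linarith
  refine memS_of_decay hω (continuous_gaussSum hb0) (fun l hl => ?_) fun l hl => ?_
  · obtain ⟨L, C, hC, hlL, h⟩ := exists_exp_mul_gauss_le (N := N) hω hl.le le_rfl
    refine ⟨C * ∑' j, ‖b j‖ * Real.exp (L * ω ‖x j‖), fun y => ?_⟩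
    have hs := (((hb L (hl.trans_le hlL)).mul_left C).mul_right (Real.exp (-(l * ω ‖y‖)))).hasSum
    rw [tsum_mul_right, tsum_mul_left] at hs
    refine tsum_of_norm_bounded hs fun j => ?_
    have h1 := h (x j) y
    rw [zero_mul, neg_zero, Real.exp_zero, mul_one] at h1
    have h2 : ‖gauss N (y - x j)‖ ≤ C * Real.exp (L * ω ‖x j‖) * Real.exp (-(l * ω ‖y‖)) := by
      rw [Real.exp_neg, ← div_eq_mul_inv, le_div_iff₀ (Real.exp_pos _), mul_comm]
      exact h1
    rw [norm_mul]
    calc ‖b j‖ * ‖gauss N (y - x j)‖ ≤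
          ‖b j‖ * (C * Real.exp (L * ω ‖x j‖) * Real.exp (-(l * ω ‖y‖))) := by gcongr
      _ = _ := by ring
  · obtain ⟨C, hC, h⟩ := exists_norm_gauss_le (N := N) hω hl.le
    refine ⟨(∑' j, ‖b j‖) * C, fun ξ => ?_⟩
    rw [fourier_gaussSum hω hb0, mul_assoc]
    refine tsum_of_norm_bounded (hb0.hasSum.mul_right _) fun j => ?_
    rw [norm_mul, norm_fourier_comp_sub (gauss N), fourier_gauss]
    gcongr
    exact h ξ

theorem gaussSum_single (j : ℕ) (z : ℂ) (hb : ∀ i, i ≠ j → b i = 0) (hz : b j = z) :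
    gaussSum x b = fun y => z * gauss N (y - x j) := by
  funext y
  rw [gaussSum, tsum_eq_single j fun i hi => by rw [hb i hi, zero_mul], hz]

end gaussSum

theorem memS_gauss_sub (hω : IsWeight ω) (x : Space N) : MemS N ω fun y => gauss N (y - x) := by
  have h := memS_gaussSum (N := N) hω (x := fun _ => x) (b := fun j => if j = 0 then 1 else 0)
    fun l _ => summable_of_ne_finset_zero (s := {0}) fun j hj => by
      rw [Finset.mem_singleton] at hj
      simp [hj]
  rw [gaussSum_single 0 1 (fun i hi => if_neg hi) (if_pos rfl)] at h
  simpa using h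

/-! ### Multipliers are slowly increasing -/

/-- Absolutely summable complex sequences. -/
abbrev SeqL1 : Type := lp (fun _ : ℕ => ℂ) 1

theorem SeqL1.summable (a : SeqL1) : Summable fun j => ‖a j‖ := by
  simpa using (lp.memℓp a).summable (by simp)

theorem SeqL1.norm_eq (a : SeqL1) : ‖a‖ = ∑' j, ‖a j‖ := by
  rw [lp.norm_eq_tsum_rpow (by simp)]
  simp

/-- The short-time Fourier transform of a multiplier `f` decays in frequency, with at most
exponential growth in `ω` in time. Otherwise there are points `x_j` where it is large, and
superpositions of Gaussians centred at these points, with coefficients `a_j d_j`, where `a` is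
summable and `d_j = exp(-(j + 1) ω(x_j))`, belong to `S_ω`. The uniform boundedness principle,
applied to functionals of `a`, is in contradiction with the choice of the points. -/
theorem exists_decay_fourier_windowed (hω : IsWeight ω) {f : Space N → ℂ}
    (hM : ∀ g, MemS N ω g → MemS N ω fun x => f x * g x) {l : ℝ} (hl : 0 < l) :
    ∃ C : ℝ, 0 < C ∧ ∃ n : ℕ, 1 ≤ n ∧ ∀ x : Space N,
      Decay ω l (C * Real.exp (n * ω ‖x‖)) (𝓕 (windowed f x)) := by
  by_contra! hcon
  have hcon' : ∀ j : ℕ, ∃ x ξ : Space N, ((j + 1 : ℕ) : ℝ) * Real.exp ((j + 1 : ℕ) * ω ‖x‖) *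
      Real.exp (-(l * ω ‖ξ‖)) < ‖𝓕 (windowed f x) ξ‖ := by
    intro j
    obtain ⟨x, hx⟩ := hcon (j + 1 : ℕ) (by positivity) (j + 1) (Nat.le_add_left 1 j)
    simp only [Decay, not_forall, not_le] at hx
    obtain ⟨ξ, hξ⟩ := hx
    exact ⟨x, ξ, hξ⟩
  choose x ξ hxξ using hcon'
  obtain ⟨c, hc, hci⟩ := hω.integrable_exp_neg N
  set d : ℕ → ℝ := fun j => Real.exp (-((j + 1 : ℕ) * ω ‖x j‖)) with hd
  have hωx : ∀ j, 0 ≤ ω ‖x j‖ := fun j => hω.nonneg _ (norm_nonneg _)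
  have hd1 : ∀ j, ‖(d j : ℂ)‖ ≤ 1 := by
    intro j
    rw [Complex.norm_real, Real.norm_of_nonneg (Real.exp_pos _).le, Real.exp_le_one_iff, neg_nonpos]
    have := hωx j
    positivity
  have hcoef : ∀ (a : SeqL1) j, ‖a j * d j‖ ≤ ‖a j‖ := fun a j => by
    rw [norm_mul]
    exact mul_le_of_le_one_right (norm_nonneg _) (hd1 j)
  have hsum : ∀ a : SeqL1, Summable fun j => ‖a j * d j‖ := fun a =>
    .of_nonneg_of_le (fun j => norm_nonneg _) (hcoef a) a.summable
  -- the superposition depends linearly on the coefficients and belongs to `S_ω`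
  set G : SeqL1 → Space N → ℂ := fun a => gaussSum x fun j => a j * d j with hG
  have hGadd : ∀ a b : SeqL1, G (a + b) = G a + G b := by
    intro a b
    simp only [hG]
    rw [← gaussSum_add (hsum a) (hsum b)]
    congr 1
    funext j
    rw [lp.coeFn_add, Pi.add_apply, add_mul]
  have hGsmul : ∀ (z : ℂ) (a : SeqL1), G (z • a) = z • G a := by
    intro z a
    simp only [hG]
    rw [← gaussSum_smul]
    congr 1
    funext j
    rw [lp.coeFn_smul, Pi.smul_apply, smul_eq_mul, mul_assoc]
  have hGnorm : ∀ (a : SeqL1) y, ‖G a y‖ ≤ ‖a‖ := by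
    intro a y
    rw [SeqL1.norm_eq]
    exact (norm_gaussSum_le (hsum a) y).trans ((hsum a).tsum_le_tsum (hcoef a) a.summable)
  have hGmem : ∀ a : SeqL1, MemS N ω (G a) := by
    intro a
    refine memS_gaussSum hω fun m _ => ?_
    obtain ⟨n, hn⟩ := exists_nat_ge m
    refine .of_norm_bounded_eventually_nat a.summable ?_
    filter_upwards [eventually_ge_atTop n] with j hj
    have hjm : m ≤ (j + 1 : ℕ) := by
      refine hn.trans ?_
      exact_mod_cast hj.trans (Nat.le_succ j)
    rw [Real.norm_of_nonneg (by positivity), norm_mul, Complex.norm_real,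
      Real.norm_of_nonneg (Real.exp_pos _).le, mul_assoc, ← Real.exp_add]
    refine mul_le_of_le_one_right (norm_nonneg _) ?_
    rw [Real.exp_le_one_iff]
    nlinarith [mul_le_mul_of_nonneg_right hjm (hωx j)]
  have hfG : ∀ a : SeqL1, MemS N ω fun y => f y * G a y := fun a => hM _ (hGmem a)
  -- the product with `f` depends continuously on the coefficients
  let ev : Space N → SeqL1 →L[ℂ] ℂ := fun y => LinearMap.mkContinuous
    { toFun := fun a => (Real.exp (c * ω ‖y‖) : ℂ) * (f y * G a y)
      map_add' := fun a b => by rw [hGadd, Pi.add_apply]; ring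
      map_smul' := fun z a => by
        rw [hGsmul, Pi.smul_apply, smul_eq_mul, RingHom.id_apply, smul_eq_mul]; ring }
    (‖(Real.exp (c * ω ‖y‖) : ℂ)‖ * ‖f y‖) fun a => by
      change ‖(Real.exp (c * ω ‖y‖) : ℂ) * (f y * G a y)‖ ≤ _
      rw [norm_mul, norm_mul, mul_assoc]
      gcongr
      exact hGnorm a y
  have hev : ∀ y a, ‖ev y a‖ = Real.exp (c * ω ‖y‖) * ‖f y * G a y‖ := by
    intro y a
    change ‖(Real.exp (c * ω ‖y‖) : ℂ) * (f y * G a y)‖ = _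
    rw [norm_mul, Complex.norm_real, Real.norm_of_nonneg (Real.exp_pos _).le]
  obtain ⟨C₁, hC₁⟩ := banach_steinhaus (g := ev) fun a =>
    ⟨weightedSup ω c fun y => f y * G a y, fun y => by
      rw [hev]
      have := (hfG a).bdd c hc 0
      rw [multiD_zero_index] at this
      exact this.le y⟩
  have hdec : ∀ a : SeqL1, Decay ω c (C₁ * ‖a‖) fun y => f y * G a y := by
    intro a y
    rw [Real.exp_neg, ← div_eq_mul_inv, le_div_iff₀ (Real.exp_pos _), mul_comm, ← hev]
    exact (ev y).le_of_opNorm_le (hC₁ y) a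
  -- hence so does its Fourier transform
  have hFadd : ∀ a b η, 𝓕 (fun y => f y * G (a + b) y) η =
      𝓕 (fun y => f y * G a y) η + 𝓕 (fun y => f y * G b y) η := by
    intro a b η
    rw [Real.fourier_eq, Real.fourier_eq, Real.fourier_eq, ← integral_add
      ((Real.fourierIntegral_convergent_iff η).2 (hfG a).integrable)
      ((Real.fourierIntegral_convergent_iff η).2 (hfG b).integrable)]
    congr 1
    funext y
    rw [hGadd, Pi.add_apply, mul_add, smul_add]
  have hFsmul : ∀ (z : ℂ) (a : SeqL1) η, 𝓕 (fun y => f y * G (z • a) y) η =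
      z * 𝓕 (fun y => f y * G a y) η := by
    intro z a η
    rw [Real.fourier_eq, Real.fourier_eq, ← integral_const_mul]
    congr 1
    funext y
    rw [hGsmul, Pi.smul_apply]
    simp only [Circle.smul_def, smul_eq_mul]
    ring
  set I : ℝ := ∫ ξ : Space N, Real.exp (-(c * ω ‖ξ‖)) with hI
  let T : Space N → SeqL1 →L[ℂ] ℂ := fun η => LinearMap.mkContinuous
    { toFun := fun a => (Real.exp (l * ω ‖η‖) : ℂ) * 𝓕 (fun y => f y * G a y) η
      map_add' := fun a b => by rw [hFadd, mul_add]
      map_smul' := fun z a => by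
        rw [hFsmul, RingHom.id_apply, smul_eq_mul]; ring }
    (‖(Real.exp (l * ω ‖η‖) : ℂ)‖ * (C₁ * I)) fun a => by
      change ‖(Real.exp (l * ω ‖η‖) : ℂ) * 𝓕 (fun y => f y * G a y) η‖ ≤ _
      rw [norm_mul, mul_assoc]
      gcongr
      refine (norm_fourier_le_integral_norm _ _).trans ?_
      refine (integral_mono_of_nonneg (Eventually.of_forall fun _ => norm_nonneg _)
        (hci.const_mul _) (Eventually.of_forall (hdec a))).trans_eq ?_
      rw [integral_const_mul]
      ring
  have hT : ∀ η a, ‖T η a‖ = Real.exp (l * ω ‖η‖) * ‖𝓕 (fun y => f y * G a y) η‖ := by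
    intro η a
    change ‖(Real.exp (l * ω ‖η‖) : ℂ) * 𝓕 (fun y => f y * G a y) η‖ = _
    rw [norm_mul, Complex.norm_real, Real.norm_of_nonneg (Real.exp_pos _).le]
  obtain ⟨C₂, hC₂⟩ := banach_steinhaus (g := T) fun a =>
    ⟨weightedSup ω l (fourierT fun y => f y * G a y), fun η => by
      rw [hT, mul_comm]
      have := ((hfG a).decay_fourierT hl).fourier_of_fourierT hω hl.le η
      rwa [Real.exp_neg, ← div_eq_mul_inv, le_div_iff₀ (Real.exp_pos _)] at this⟩
  -- test the uniform bound on the `j`-th unit sequence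
  obtain ⟨j, hj⟩ := exists_nat_ge C₂
  set a : SeqL1 := lp.single 1 j 1 with ha
  have han : ‖a‖ = 1 := by
    rw [ha, lp.norm_single (by simp)]
    simp
  have hGa : (fun y => f y * G a y) = fun y => (d j : ℂ) * windowed f (x j) y := by
    have h1 : G a = fun y => (d j : ℂ) * gauss N (y - x j) := by
      refine gaussSum_single j _ (fun i hi => ?_) ?_
      · rw [ha, lp.single_apply_ne _ _ _ hi, zero_mul]
      · rw [ha, lp.single_apply_self, one_mul]
    funext y
    rw [h1, windowed]
    ring
  have h1 := (T (ξ j)).le_of_opNorm_le (hC₂ (ξ j)) a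
  have h2 : ‖𝓕 (fun y => f y * G a y) (ξ j)‖ = d j * ‖𝓕 (windowed f (x j)) (ξ j)‖ := by
    have : 𝓕 (fun y => f y * G a y) (ξ j) = (d j : ℂ) * 𝓕 (windowed f (x j)) (ξ j) := by
      rw [hGa, Real.fourier_eq, Real.fourier_eq, ← integral_const_mul]
      congr 1
      funext y
      simp only [Circle.smul_def, smul_eq_mul]
      ring
    rw [this, norm_mul, Complex.norm_real, Real.norm_of_nonneg (Real.exp_pos _).le]
  rw [hT, han, mul_one, h2] at h1
  have h3 : Real.exp (l * ω ‖ξ j‖) * (d j * (((j + 1 : ℕ) : ℝ) * Real.exp ((j + 1 : ℕ) * ω ‖x j‖) *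
      Real.exp (-(l * ω ‖ξ j‖)))) = ((j + 1 : ℕ) : ℝ) := by
    have e1 : Real.exp (l * ω ‖ξ j‖) * Real.exp (-(l * ω ‖ξ j‖)) = 1 := by
      rw [← Real.exp_add]; simp
    have e2 : d j * Real.exp ((j + 1 : ℕ) * ω ‖x j‖) = 1 := by
      rw [hd, ← Real.exp_add]; simp
    calc _ = ((j + 1 : ℕ) : ℝ) * (Real.exp (l * ω ‖ξ j‖) * Real.exp (-(l * ω ‖ξ j‖))) *
          (d j * Real.exp ((j + 1 : ℕ) * ω ‖x j‖)) := by ring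
      _ = _ := by rw [e1, e2]; ring
  have hdj : 0 < d j := Real.exp_pos _
  have h4 : ((j + 1 : ℕ) : ℝ) < C₂ := by
    rw [← h3]
    refine lt_of_lt_of_le ?_ h1
    gcongr
    exact hxξ j
  push_cast at h4
  linarith

theorem mem_OM_of_multiplier (hω : IsWeight ω) {f : Space N → ℂ} (hf : ContDiff ℝ (⊤ : ℕ∞) f)
    (hM : ∀ g, MemS N ω g → MemS N ω fun x => f x * g x) : f ∈ OM N ω := by
  rw [mem_OM_iff hf]
  intro m hm
  have hm0 : (0 : ℝ) < m := by exact_mod_cast hm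
  obtain ⟨L, C, hL, hC, h⟩ := exists_iteratedFDeriv_le_of_windowed hω N hm0
  obtain ⟨C', hC', n, hn, h'⟩ := exists_decay_fourier_windowed hω hM hL
  refine ⟨C * C', by positivity, n, hn, fun α x hα => ?_⟩
  refine (norm_multiD_le hf α x).trans ((h f hf x _ ?_ (h' x) _ hα).trans_eq ?_)
  · exact (hM _ (memS_gauss_sub hω x)).integrable
  · ring

end BeurlingMultipliers

end

theorem theorem4p4 (N : ℕ) (ω : ℝ → ℝ) (hω : BeurlingMultipliers.IsWeight ω)
    (f : BeurlingMultipliers.Space N → ℂ) (hf : ContDiff ℝ (⊤ : ℕ∞) f) :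
    (f ∈ BeurlingMultipliers.OM N ω ↔
      ∀ g : BeurlingMultipliers.Space N → ℂ,
        BeurlingMultipliers.MemS N ω g → BeurlingMultipliers.MemS N ω (fun x => f x * g x)) ∧
    (f ∈ BeurlingMultipliers.OM N ω →
      ∃ M : BeurlingMultipliers.S N ω →L[ℂ] BeurlingMultipliers.S N ω,
        ∀ g x, (M g).toFun x = f x * g.toFun x) :=
  ⟨⟨fun hO _ hg => hg.mul_of_mem_OM hω hf hO,
    fun hM => BeurlingMultipliers.mem_OM_of_multiplier hω hf hM⟩,
    fun hO => BeurlingMultipliers.exists_multiplication_operator hω hf hO⟩
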